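/- Let $N\ge 2$. Consider the bipartite Bell scenario in which Alice has settings $A_1,A_3,\dots,A_{2N-1}$, Bob has settings $B_2,B_4,\dots,B_{2N}$, and all outcomes lie in $\{1,-1\}$. A realization consists of a unit vector $\psi\in\mathcal H_A\otimes\mathcal H_B$ (complex inner product spaces) and orthogonal projections $\Pi^A_{a|x}$ on $\mathcal H_A$, $\Pi^B_{b|y}$ on $\mathcal H_B$; it consists of projective measurements if $\Pi^A_{1|x}+\Pi^A_{-1|x}=I$ and $\Pi^B_{1|y}+\Pi^B_{-1|y}=I$ for all $x,y$, and it is rank-one if all these projections have rank one. Put $P(a,b|x,y)=\langle\psi,(\Pi^A_{a|x}\otimes\Pi^B_{b|y})\psi\rangle$, $\langle A_xB_y\rangle=\sum_{a,b}ab\,P(a,b|x,y)$, and let $$I_N=\langle A_1B_2\rangle+\langle A_3B_2\rangle+\langle A_3B_4\rangle+\langle A_5B_4\rangle+\cdots+\langle A_{2N-1}B_{2N}\rangle-\langle A_1B_{2N}\rangle$$ be the chained Bell expression. The reference realization is the state $\psi_0=(|00\rangle+|11\rangle)/\sqrt2\in\mathbb C^2\otimes\mathbb C^2$ with the eigenprojections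 $P_{a|x},Q_{b|y}$ of the observables $\cos\varphi_k\,Z+\sin\varphi_k\,X$, $\varphi_k=(k-1)\pi/(2N)$, where $k=1,3,\dots,2N-1$ for Alice and $k=2,4,\dots,2N$ for Bob ($Z,X$ are the Pauli matrices). The events of $I_N$ are the $4N$ events $(a,b|x,y)$ with $(x,y)$ occurring in $I_N$ and $ab$ equal to the sign of $\langle A_xB_y\rangle$ in $I_N$; two events are exclusive if some party has the same setting but different outcomes in them. Let $G_N$ be the graph of exclusivity. The theta program of $G_N$ is to maximize $\sum_i X_{ii}$ over positive semidefinite matrices $X$ indexed by $\{0\}$ and the events, with $X_{00}=1$, $X_{ii}=X_{0i}$ for every event $i$, and $X_{ij}=0$ for $i\sim j$. The matrix of a realization is $X_{ij}=\langle\psi,\Pi_j\Pi_i\psi\rangle$ with $\Pi_0=I$ and $\Pi_i=\Pi^A_{a|x}\otimes\Pi^B_{b|y}$ for $i=(a,b|x,y)$. Then: (1) The reference realization consists of rank-one projective measurements and attains $I_N=2N\cos(\pi/2N)$; every realization by projective measurements (of any ranks) satisfies $I_N\le 2N\cos(\pi/2N)$. (2) (Self-testing) For every realization $(\psi',\{\Pi'^A_{a|x}\},\{\Pi'^B_{b|y}\})$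 on $\mathcal H_A'\otimes\mathcal H_B'$ by rank-one projective measurements that attains $I_N=2N\cos(\pi/2N)$ there are unitaries $V_A:\mathbb C^2\to\mathcal H_A'$ and $V_B:\mathbb C^2\to\mathcal H_B'$ such that $(V_A\otimes V_B)\psi_0=\psi'$ and $(V_A\otimes V_B)(P_{a|x}\otimes Q_{b|y})\psi_0=(\Pi'^A_{a|x}\otimes\Pi'^B_{b|y})\psi'$ for all $a,b,x,y$. (3) $G_N$ is isomorphic to the Möbius ladder $Ci_{4N}(1,2N)$, its Lovász theta number is $N(1+\cos(\pi/2N))$, and the matrix of the reference realization is the unique maximizer of the theta program of $G_N$. (4) For every rank-one realization $(\psi',\{\Pi'^A_{a|x}\},\{\Pi'^B_{b|y}\})$ on $\mathcal H_A'\otimes\mathcal H_B'$ (the projections of a setting need not sum to the identity) whose matrix is a maximizer of the theta program of $G_N$ there are isometries $V_A:\mathbb C^2\to\mathcal H_A'$ and $V_B:\mathbb C^2\to\mathcal H_B'$ with $(V_A\otimes V_B)\psi_0=\psi'$ and $(V_A\otimes V_B)(P_{a|x}\otimes Q_{b|y})\psi_0=(\Pi'^A_{a|x}\otimes\Pi'^B_{b|y})\psi'$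 for all $a,b,x,y$. -/

import Mathlib

open scoped TensorProduct ComplexOrder

universe u v

/-! ### Bipartite quantum realizations with `N` two-outcome settings per party -/

/-- A quantum realization for two parties with `N` settings each and outcomes in `{1, -1} = ℤˣ`:
a unit vector in the tensor product of the two local (complex inner product) spaces, and an
orthogonal projection for each party, setting and outcome. That the two projections of a setting
form a measurement is the separate predicate `IsMeasurement`. -/
structure BellRealization (N : ℕ) (HA HB : Type*)
    [NormedAddCommGroup HA] [InnerProductSpace ℂ HA]
    [NormedAddCommGroup HB] [InnerProductSpace ℂ HB] where
  /-- the shared state -/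
  state : HA ⊗[ℂ] HB
  norm_state : ‖state‖ = 1
  /-- `projA x a` is Alice's projection for outcome `a` of setting `x` -/
  projA : Fin N → ℤˣ → (HA →ₗ[ℂ] HA)
  /-- `projB y b` is Bob's projection for outcome `b` of setting `y` -/
  projB : Fin N → ℤˣ → (HB →ₗ[ℂ] HB)
  projA_isProj : ∀ x a, (projA x a).IsSymmetricProjection
  projB_isProj : ∀ y b, (projB y b).IsSymmetricProjection

namespace BellRealization

variable {N : ℕ} {HA HB : Type*}
  [NormedAddCommGroup HA] [InnerProductSpace ℂ HA]
  [NormedAddCommGroup HB] [InnerProductSpace ℂ HB]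

/-- For each setting the projections sum to the identity (so each setting is a projective
measurement). -/
def IsMeasurement (S : BellRealization N HA HB) : Prop :=
  (∀ x, ∑ a : ℤˣ, S.projA x a = LinearMap.id) ∧ (∀ y, ∑ b : ℤˣ, S.projB y b = LinearMap.id)

/-- All local projections have rank one. -/
def IsRankOne (S : BellRealization N HA HB) : Prop :=
  (∀ x a, Module.finrank ℂ (LinearMap.range (S.projA x a)) = 1) ∧
  (∀ y b, Module.finrank ℂ (LinearMap.range (S.projB y b)) = 1)

/-- The vector `(Π^A_{a|x} ⊗ Π^B_{b|y}) ψ`. -/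
noncomputable def eventVec (S : BellRealization N HA HB) (x y : Fin N) (a b : ℤˣ) : HA ⊗[ℂ] HB :=
  TensorProduct.map (S.projA x a) (S.projB y b) S.state

/-- The probability `P(a, b | x, y) = ⟨ψ, (Π^A_{a|x} ⊗ Π^B_{b|y}) ψ⟩`. -/
noncomputable def prob (S : BellRealization N HA HB) (x y : Fin N) (a b : ℤˣ) : ℝ :=
  (inner ℂ S.state (S.eventVec x y a b)).re

/-- The correlator `⟨A_x B_y⟩`, the expectation of the product of the outcomes. -/
noncomputable def correlator (S : BellRealization N HA HB) (x y : Fin N) : ℝ :=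
  ∑ a : ℤˣ, ∑ b : ℤˣ, (((a * b : ℤˣ) : ℤ) : ℝ) * S.prob x y a b

end BellRealization

/-! ### The chained Bell expression

Alice's `N` settings (traditionally labelled `1, 3, …, 2N-1`) are numbered `0, …, N-1`, and so are
Bob's (traditionally `2, 4, …, 2N`). The expression has `2N` terms, numbered by `e : Fin (2 * N)`:
`⟨A_1 B_2⟩, ⟨A_3 B_2⟩, ⟨A_3 B_4⟩, …, ⟨A_{2N-1} B_{2N}⟩, -⟨A_1 B_{2N}⟩`. -/

/-- Alice's setting in the `e`-th term: `0, 1, 1, 2, 2, …, N-1, N-1, 0`. -/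
def chainA {N : ℕ} (e : Fin (2 * N)) : Fin N :=
  ⟨((e : ℕ) + 1) / 2 % N, Nat.mod_lt _ (by have := e.isLt; omega)⟩

/-- Bob's setting in the `e`-th term: `0, 0, 1, 1, …, N-1, N-1`. -/
def chainB {N : ℕ} (e : Fin (2 * N)) : Fin N :=
  ⟨(e : ℕ) / 2, by have := e.isLt; omega⟩

/-- The sign of the `e`-th term: `-1` for the last term and `1` for the others. -/
def chainSign {N : ℕ} (e : Fin (2 * N)) : ℤˣ :=
  if (e : ℕ) + 1 = 2 * N then -1 else 1

/-- The chained Bell expression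
`⟨A_1 B_2⟩ + ⟨A_3 B_2⟩ + ⟨A_3 B_4⟩ + ⋯ + ⟨A_{2N-1} B_{2N}⟩ - ⟨A_1 B_{2N}⟩`. -/
noncomputable def chainedBell {N : ℕ} {HA HB : Type*}
    [NormedAddCommGroup HA] [InnerProductSpace ℂ HA]
    [NormedAddCommGroup HB] [InnerProductSpace ℂ HB] (S : BellRealization N HA HB) : ℝ :=
  ∑ e : Fin (2 * N), ((chainSign e : ℤ) : ℝ) * S.correlator (chainA e) (chainB e)

/-! ### The events of the chained Bell expression and their graph of exclusivity -/

/-- The `4N` events: the pair `(e, a)` is the event that, for the settings of the `e`-th term,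
Alice obtains `a` and Bob obtains `a` times the sign of the term. -/
abbrev ChainEvent (N : ℕ) : Type := Fin (2 * N) × ℤˣ

/-- Bob's outcome in an event. -/
def ChainEvent.outB {N : ℕ} (i : ChainEvent N) : ℤˣ := chainSign i.1 * i.2

/-- Two events are exclusive if one of the parties has the same setting and different outcomes
in them. -/
def chainedExclusivityGraph (N : ℕ) : SimpleGraph (ChainEvent N) where
  Adj i j :=
    (chainA i.1 = chainA j.1 ∧ i.2 ≠ j.2) ∨ (chainB i.1 = chainB j.1 ∧ i.outB ≠ j.outB)
  symm := ⟨fun _ _ h => h.imp (fun h => ⟨h.1.symm, h.2.symm⟩) (fun h => ⟨h.1.symm, h.2.symm⟩)⟩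
  loopless := ⟨fun _ h => h.elim (fun h => h.2 rfl) (fun h => h.2 rfl)⟩

/-! ### The Lovász theta semidefinite program -/

/-- Feasibility for the Lovász theta program of `G`; the extra index `0` is `none`. -/
structure ThetaFeasible {V : Type*} (G : SimpleGraph V) (X : Matrix (Option V) (Option V) ℂ) :
    Prop where
  posSemidef : X.PosSemidef
  corner : X none none = 1
  diag : ∀ i : V, X (some i) (some i) = X none (some i)
  edge : ∀ i j : V, G.Adj i j → X (some i) (some j) = 0

/-- The (unit weight) objective `∑ i, X i i` of the Lovász theta program. -/
noncomputable def thetaObjective {V : Type*} [Fintype V] (X : Matrix (Option V) (Option V) ℂ) : ℝ :=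
  ∑ i : V, (X (some i) (some i)).re

/-- `X` is a maximizer of the Lovász theta program of `G`. -/
def IsThetaOptimal {V : Type*} [Fintype V] (G : SimpleGraph V)
    (X : Matrix (Option V) (Option V) ℂ) : Prop :=
  ThetaFeasible G X ∧
    ∀ Y : Matrix (Option V) (Option V) ℂ, ThetaFeasible G Y → thetaObjective Y ≤ thetaObjective X

/-- The vectors `Π_i ψ` of a realization, where `Π_0` is the identity and, for an event `i`,
`Π_i` is the product of the local projections of `i`. -/
noncomputable def chainedVec {N : ℕ} {HA HB : Type*}
    [NormedAddCommGroup HA] [InnerProductSpace ℂ HA]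
    [NormedAddCommGroup HB] [InnerProductSpace ℂ HB] (S : BellRealization N HA HB) :
    Option (ChainEvent N) → HA ⊗[ℂ] HB
  | none => S.state
  | some i => S.eventVec (chainA i.1) (chainB i.1) i.2 i.outB

/-- The matrix `X i j = ⟨ψ, Π_j Π_i ψ⟩` of a realization. -/
noncomputable def chainedGram {N : ℕ} {HA HB : Type*}
    [NormedAddCommGroup HA] [InnerProductSpace ℂ HA]
    [NormedAddCommGroup HB] [InnerProductSpace ℂ HB] (S : BellRealization N HA HB) :
    Matrix (Option (ChainEvent N)) (Option (ChainEvent N)) ℂ :=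
  fun i j => inner ℂ (chainedVec S j) (chainedVec S i)

/-! ### The standard two-qubit realization -/

/-- The state space of a qubit. -/
abbrev Qubit : Type := EuclideanSpace ℂ (Fin 2)

/-- The qubit vector `cos t |0⟩ + sin t |1⟩`. -/
noncomputable def qubitVec (t : ℝ) : Qubit := !₂[(Real.cos t : ℂ), (Real.sin t : ℂ)]

theorem norm_qubitVec (t : ℝ) : ‖qubitVec t‖ = 1 := by
  rw [EuclideanSpace.norm_eq]
  simp only [qubitVec, Fin.sum_univ_two, Complex.norm_real, Real.norm_eq_abs, sq_abs,
    Matrix.cons_val_zero, Matrix.cons_val_one]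
  simp

/-- The eigenprojection for the eigenvalue `a` of the observable `cos φ Z + sin φ X`
(`Z`, `X` Pauli matrices): the projection onto `cos (φ/2) |0⟩ + sin (φ/2) |1⟩` for `a = 1` and
onto `-sin (φ/2) |0⟩ + cos (φ/2) |1⟩` for `a = -1`. -/
noncomputable def qubitProj (φ : ℝ) (a : ℤˣ) : Qubit →ₗ[ℂ] Qubit :=
  let v := qubitVec (if a = 1 then φ / 2 else φ / 2 + Real.pi / 2)
  (InnerProductSpace.rankOne ℂ v v).toLinearMap

theorem qubitProj_isSymmetricProjection (φ : ℝ) (a : ℤˣ) :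
    (qubitProj φ a).IsSymmetricProjection :=
  InnerProductSpace.isSymmetricProjection_rankOne_self (norm_qubitVec _)

/-- The maximally entangled state `(|00⟩ + |11⟩) / √2`. -/
noncomputable def phiPlus : Qubit ⊗[ℂ] Qubit :=
  ((1 / Real.sqrt 2 : ℝ) : ℂ) •
    (EuclideanSpace.single 0 1 ⊗ₜ[ℂ] EuclideanSpace.single 0 1 +
      EuclideanSpace.single 1 1 ⊗ₜ[ℂ] EuclideanSpace.single 1 1)

theorem norm_phiPlus : ‖phiPlus‖ = 1 := by
  have h : inner ℂ phiPlus phiPlus = (1 : ℂ) := by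
    have h2 : (1 / Real.sqrt 2) * (1 / Real.sqrt 2) = (1 / 2 : ℝ) := by
      rw [div_mul_div_comm, Real.mul_self_sqrt (by norm_num)]; norm_num
    unfold phiPlus
    rw [inner_smul_left (E := Qubit ⊗[ℂ] Qubit), inner_smul_right (E := Qubit ⊗[ℂ] Qubit),
      inner_add_left (E := Qubit ⊗[ℂ] Qubit), inner_add_right (E := Qubit ⊗[ℂ] Qubit),
      inner_add_right (E := Qubit ⊗[ℂ] Qubit), ← mul_assoc, Complex.conj_ofReal,
      ← Complex.ofReal_mul, h2]
    simp [EuclideanSpace.inner_single_left]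
    norm_num
  rw [@norm_eq_sqrt_re_inner ℂ, h]
  simp

/-- The standard two-qubit realization: the state `(|00⟩ + |11⟩) / √2` and, with the traditional
labels `k = 1, 3, …, 2N-1` of Alice's settings and `k = 2, 4, …, 2N` of Bob's, the observables
`cos φ_k Z + sin φ_k X`, where `φ_k = (k - 1) π / (2N)`. -/
noncomputable def chainedReference (N : ℕ) : BellRealization N Qubit Qubit where
  state := phiPlus
  norm_state := norm_phiPlus
  projA x a := qubitProj (2 * (x : ℕ) * (Real.pi / (2 * N))) a
  projB y b := qubitProj ((2 * (y : ℕ) + 1) * (Real.pi / (2 * N))) b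
  projA_isProj _ _ := qubitProj_isSymmetricProjection _ _
  projB_isProj _ _ := qubitProj_isSymmetricProjection _ _

/-!
Write the events as the rungs of a ladder with `2N` rungs, twisted at the end, so that the graph of
exclusivity is the Möbius ladder. A feasible matrix of the theta program is a Gram matrix; let `f`
be the vector of the extra index, and `s e` and `d e` the sum and the difference of the two
orthogonal vectors of the rung `e`. Feasibility gives `‖s e‖ ^ 2 = ‖d e‖ ^ 2 = ⟪f, s e⟫` and
`⟪s e, s (e + 1)⟫ = ⟪d e, d (e + 1)⟫`, and `d` is antiperiodic. With `c = cos (π / 2N)`, expanding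
`0 ≤ ∑ ‖s e + s (e + 1) - (1 + c) • f‖ ^ 2` and using the discrete Wirtinger inequality
`∑ ⟪d e, d (e + 1)⟫ ≤ c * ∑ ‖d e‖ ^ 2` for antiperiodic sequences bounds the objective, which is
`∑ ‖s e‖ ^ 2`, by `N * (1 + c)`.

The Wirtinger inequality is a sum of squares (divide by the ground state `sin`), so equality forces
two-term recurrences of the sums and of the differences, and these determine the Gram matrix. For
rank-one realizations consecutive rungs share the local vectors of one party, and phases of the
local vectors can be chosen so that local isometries carry the first two rungs of the reference to
those of the realization; the recurrences extend this to all rungs.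
-/

/-! ### A discrete Wirtinger inequality for antiperiodic sequences -/

theorem sin_natCast_mul_pi_div_pos {n k : ℕ} (hk : 0 < k) (hkn : k < n) :
    0 < Real.sin (k * (Real.pi / n)) := by
  have hn : (0 : ℝ) < n := by exact_mod_cast hk.trans hkn
  refine Real.sin_pos_of_pos_of_lt_pi (mul_pos (Nat.cast_pos.2 hk) (div_pos Real.pi_pos hn)) ?_
  rw [mul_div_assoc', div_lt_iff₀ hn, mul_comm]
  exact mul_lt_mul_of_pos_left (by exact_mod_cast hkn) Real.pi_pos

section Wirtinger

variable {H : Type*} [NormedAddCommGroup H] [InnerProductSpace ℝ H]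

/-- The point at parameter `x` of the ellipse with conjugate radii `a` and `w`. The sequences
attaining equality in the Wirtinger inequality are samples of such a curve. -/
noncomputable def trigVec (a w : H) (x : ℝ) : H := Real.cos x • a + Real.sin x • w

@[simp]
theorem trigVec_zero (a w : H) : trigVec a w 0 = a := by simp [trigVec]

@[simp]
theorem trigVec_pi (a w : H) : trigVec a w Real.pi = -a := by simp [trigVec]

theorem trigVec_add_pi (a w : H) (x : ℝ) : trigVec a w (x + Real.pi) = -trigVec a w x := by
  simp only [trigVec, Real.cos_add_pi, Real.sin_add_pi]; module

theorem trigVec_add_trigVec (a w : H) (x t : ℝ) :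
    trigVec a w (x - t) + trigVec a w (x + t) = (2 * Real.cos t) • trigVec a w x := by
  simp only [trigVec, Real.cos_add, Real.cos_sub, Real.sin_add, Real.sin_sub]; module

/-- The boundary term in the summation by parts behind the Wirtinger inequality. -/
noncomputable def trigFlux (t : ℝ) (a w : H) (x : ℝ) : ℝ :=
  (inner ℝ (trigVec a w x) (trigVec a w (x - t)) + Real.sin t * inner ℝ a w) / 2

theorem trigFlux_zero (t : ℝ) (a w : H) : trigFlux t a w 0 = Real.cos t * ‖a‖ ^ 2 / 2 := by
  simp only [trigFlux, trigVec, inner_add_right, real_inner_smul_right, zero_sub, Real.cos_neg,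
    Real.sin_neg, Real.cos_zero, Real.sin_zero, one_smul, zero_smul, add_zero,
    real_inner_self_eq_norm_sq]
  ring

theorem trigFlux_pi (t : ℝ) (a w : H) : trigFlux t a w Real.pi = Real.cos t * ‖a‖ ^ 2 / 2 := by
  simp only [trigFlux, trigVec, inner_add_right, real_inner_smul_right, Real.cos_pi_sub,
    Real.sin_pi_sub, Real.cos_pi, Real.sin_pi, neg_smul, one_smul, zero_smul, add_zero,
    inner_neg_left, inner_neg_right, real_inner_self_eq_norm_sq]
  ring

theorem cos_mul_norm_trigVec_sq_sub_inner (t x : ℝ) (a w w' : H) :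
    Real.cos t * ‖trigVec a w x‖ ^ 2 - inner ℝ (trigVec a w x) (trigVec a w' (x + t)) =
      Real.sin x * Real.sin (x + t) / 2 * ‖w' - w‖ ^ 2 +
        (trigFlux t a w x - trigFlux t a w' (x + t)) := by
  simp only [trigFlux, trigVec, ← real_inner_self_eq_norm_sq, inner_add_left, inner_add_right,
    inner_sub_left, inner_sub_right, real_inner_smul_left, real_inner_smul_right,
    real_inner_comm a, real_inner_comm w w', add_sub_cancel_right, Real.cos_add, Real.cos_sub,
    Real.sin_add, Real.sin_sub]
  linear_combination (inner ℝ a w - inner ℝ a w') * Real.sin t / 2 * Real.sin_sq_add_cos_sq x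

/-- The amplitude `w` for which `E i` is the vector `trigVec (E 0) w (i * (π / n))`. When the sine
vanishes it is the junk value `0`, and any other value would serve. -/
noncomputable def trigAmplitude (n : ℕ) (E : ℕ → H) (i : ℕ) : H :=
  (Real.sin (i * (Real.pi / n)))⁻¹ • (E i - Real.cos (i * (Real.pi / n)) • E 0)

theorem trigVec_trigAmplitude {n : ℕ} {E : ℕ → H} (hE : E n = -E 0) {i : ℕ} (hi : i ≤ n) :
    trigVec (E 0) (trigAmplitude n E i) (i * (Real.pi / n)) = E i := by
  rcases Nat.eq_zero_or_pos i with rfl | hi0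
  · simp
  rcases hi.eq_or_lt with rfl | hin
  · have : (i : ℝ) ≠ 0 := by positivity
    rw [mul_div_cancel₀ _ this, trigVec_pi, hE]
  · rw [trigVec, trigAmplitude, smul_inv_smul₀ (sin_natCast_mul_pi_div_pos hi0 hin).ne',
      add_sub_cancel]

/-- Substituting `E i = cos • E 0 + sin • F i` and summing by parts leaves a positive quadratic form
in the increments of `F`. -/
theorem sum_cos_mul_norm_sq_sub_inner {n : ℕ} (hn : n ≠ 0) {E : ℕ → H} (hE : E n = -E 0) :
    ∑ i ∈ Finset.range n, (Real.cos (Real.pi / n) * ‖E i‖ ^ 2 - inner ℝ (E i) (E (i + 1))) =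
      ∑ i ∈ Finset.range n,
        Real.sin (i * (Real.pi / n)) * Real.sin ((i + 1 : ℕ) * (Real.pi / n)) / 2 *
          ‖trigAmplitude n E (i + 1) - trigAmplitude n E i‖ ^ 2 := by
  let g : ℕ → ℝ := fun i =>
    trigFlux (Real.pi / n) (E 0) (trigAmplitude n E i) (i * (Real.pi / n))
  have hg : g 0 = g n := by
    simp only [g]
    rw [mul_div_cancel₀ _ (Nat.cast_ne_zero.2 hn), trigFlux_pi, Nat.cast_zero, zero_mul,
      trigFlux_zero]
  rw [← add_zero (∑ i ∈ _, _ * ‖_‖ ^ 2), ← sub_eq_zero.2 hg, ← Finset.sum_range_sub' g n,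
    ← Finset.sum_add_distrib]
  refine Finset.sum_congr rfl fun i hi => ?_
  have hin := Finset.mem_range.1 hi
  rw [← trigVec_trigAmplitude hE hin.le, ← trigVec_trigAmplitude (i := i + 1) hE hin]
  simp only [g, Nat.cast_add, Nat.cast_one, add_one_mul]
  exact cos_mul_norm_trigVec_sq_sub_inner _ _ _ _ _

theorem sin_mul_sin_succ_nonneg {n i : ℕ} (hi : i < n) :
    0 ≤ Real.sin (i * (Real.pi / n)) * Real.sin ((i + 1 : ℕ) * (Real.pi / n)) / 2 := by
  have h : ∀ k ≤ n, 0 ≤ Real.sin (k * (Real.pi / n)) := fun k hk => by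
    rcases Nat.eq_zero_or_pos k with rfl | hk0
    · simp
    rcases hk.eq_or_lt with rfl | hkn
    · rw [mul_div_cancel₀ _ (by positivity), Real.sin_pi]
    · exact (sin_natCast_mul_pi_div_pos hk0 hkn).le
  exact div_nonneg (mul_nonneg (h i hi.le) (h (i + 1) hi)) zero_le_two

theorem sum_inner_succ_le {n : ℕ} (hn : n ≠ 0) {E : ℕ → H} (hE : E n = -E 0) :
    ∑ i ∈ Finset.range n, inner ℝ (E i) (E (i + 1)) ≤
      Real.cos (Real.pi / n) * ∑ i ∈ Finset.range n, ‖E i‖ ^ 2 := by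
  rw [← sub_nonneg, Finset.mul_sum, ← Finset.sum_sub_distrib, sum_cos_mul_norm_sq_sub_inner hn hE]
  exact Finset.sum_nonneg fun i hi =>
    mul_nonneg (sin_mul_sin_succ_nonneg (Finset.mem_range.1 hi)) (sq_nonneg _)

theorem trigAmplitude_eq_of_sum_inner_succ_eq {n : ℕ} {E : ℕ → H} (hE : E n = -E 0)
    (h : ∑ i ∈ Finset.range n, inner ℝ (E i) (E (i + 1)) =
      Real.cos (Real.pi / n) * ∑ i ∈ Finset.range n, ‖E i‖ ^ 2)
    {i : ℕ} (hi : 1 ≤ i) (hin : i < n) : trigAmplitude n E i = trigAmplitude n E 1 := by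
  rw [eq_comm, ← sub_eq_zero, Finset.mul_sum, ← Finset.sum_sub_distrib,
    sum_cos_mul_norm_sq_sub_inner (by omega) hE, Finset.sum_eq_zero_iff_of_nonneg fun i hi =>
      mul_nonneg (sin_mul_sin_succ_nonneg (Finset.mem_range.1 hi)) (sq_nonneg _)] at h
  induction i, hi using Nat.le_induction with
  | base => rfl
  | succ k hk ih =>
    have hpos := mul_pos (sin_natCast_mul_pi_div_pos (n := n) hk (by omega))
      (sin_natCast_mul_pi_div_pos k.succ_pos hin)
    have hzero := (mul_eq_zero.1 (h k (Finset.mem_range.2 (by omega)))).resolve_left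
      (half_pos hpos).ne'
    rw [← ih (by omega), ← sub_eq_zero, ← norm_eq_zero, ← sq_eq_zero_iff, hzero]

theorem exists_eq_trigVec_of_sum_inner_succ_eq {n : ℕ} (hn : n ≠ 0) {E : ℕ → H}
    (hE : Function.Antiperiodic E n)
    (h : ∑ i ∈ Finset.range n, inner ℝ (E i) (E (i + 1)) =
      Real.cos (Real.pi / n) * ∑ i ∈ Finset.range n, ‖E i‖ ^ 2) :
    ∃ w, ∀ i : ℕ, E i = trigVec (E 0) w (i * (Real.pi / n)) := by
  refine ⟨trigAmplitude n E 1, fun i => ?_⟩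
  induction i using Nat.strong_induction_on with
  | _ i ih =>
    rcases Nat.eq_zero_or_pos i with rfl | hi0
    · simp
    rcases lt_or_ge i n with hin | hin
    · rw [← trigAmplitude_eq_of_sum_inner_succ_eq hE.eq h hi0 hin,
        trigVec_trigAmplitude hE.eq hin.le]
    · obtain ⟨k, rfl⟩ := Nat.exists_eq_add_of_le' hin
      have hn' : (n : ℝ) ≠ 0 := Nat.cast_ne_zero.2 hn
      rw [hE, Nat.cast_add, add_mul, mul_div_cancel₀ _ hn', trigVec_add_pi,
        ← ih k (by omega)]

theorem add_add_two_eq_smul_of_sum_inner_succ_eq {n : ℕ} (hn : n ≠ 0) {E : ℕ → H}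
    (hE : Function.Antiperiodic E n)
    (h : ∑ i ∈ Finset.range n, inner ℝ (E i) (E (i + 1)) =
      Real.cos (Real.pi / n) * ∑ i ∈ Finset.range n, ‖E i‖ ^ 2) (i : ℕ) :
    E i + E (i + 2) = (2 * Real.cos (Real.pi / n)) • E (i + 1) := by
  obtain ⟨w, hw⟩ := exists_eq_trigVec_of_sum_inner_succ_eq hn hE h
  rw [hw i, hw (i + 1), hw (i + 2), ← trigVec_add_trigVec]
  congr 2 <;> push_cast <;> ring

end Wirtinger

/-! ### Vector solutions of the theta program of a Möbius ladder -/

section AnglesOfPolygon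

variable {n : ℕ}

theorem sin_pi_div_pos (hn : 2 ≤ n) : 0 < Real.sin (Real.pi / n) := by
  simpa using sin_natCast_mul_pi_div_pos (n := n) one_pos (by omega)

theorem cos_pi_div_pos (hn : 3 ≤ n) : 0 < Real.cos (Real.pi / n) := by
  have hsin_two := sin_natCast_mul_pi_div_pos (n := n) two_pos (by omega)
  rw [Nat.cast_ofNat, Real.sin_two_mul] at hsin_two
  have hsin := sin_pi_div_pos (n := n) (by omega)
  exact pos_of_mul_pos_right hsin_two (by positivity)

theorem cos_pi_div_sq_lt_one (hn : 2 ≤ n) : Real.cos (Real.pi / n) ^ 2 < 1 := by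
  have := Real.sin_sq_add_cos_sq (Real.pi / n)
  have := pow_pos (sin_pi_div_pos hn) 2
  linarith

theorem cos_pi_div_lt_one (hn : 2 ≤ n) : Real.cos (Real.pi / n) < 1 :=
  (abs_lt.1 ((sq_lt_one_iff_abs_lt_one _).1 (cos_pi_div_sq_lt_one hn))).2

theorem one_add_cos_pi_div_pos (hn : 2 ≤ n) : 0 < 1 + Real.cos (Real.pi / n) := by
  have := (abs_lt.1 ((sq_lt_one_iff_abs_lt_one _).1 (cos_pi_div_sq_lt_one hn))).1
  linarith

end AnglesOfPolygon

section Ladder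

variable {H : Type*} [NormedAddCommGroup H] [InnerProductSpace ℂ H]

attribute [local instance] InnerProductSpace.complexToReal

/-- Vectors feasible for the theta program of the ladder with `n` rungs, closed up with a twist.
The rungs are numbered by `e : ℕ` and the two ends of a rung by a sign; the rails join `(e, b)` to
`(e + 1, -b)`, and going once around the ladder exchanges the ends. For even `n` this is the
Möbius ladder. -/
structure IsLadderFamily (n : ℕ) (f : H) (v : ℕ → ℤˣ → H) : Prop where
  norm_base : ‖f‖ = 1
  shift : ∀ e b, v (e + n) b = v e (-b)
  diag : ∀ e b, inner ℂ (v e b) (v e b) = inner ℂ f (v e b)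
  rung : ∀ e b, inner ℂ (v e b) (v e (-b)) = 0
  link : ∀ e b, inner ℂ (v e b) (v (e + 1) (-b)) = 0

/-- The sum of the vectors at the two ends of a rung. -/
def ladderSum (v : ℕ → ℤˣ → H) (e : ℕ) : H := v e 1 + v e (-1)

/-- The difference of the vectors at the two ends of a rung. -/
def ladderDiff (v : ℕ → ℤˣ → H) (e : ℕ) : H := v e 1 - v e (-1)

theorem eq_ladderSum_add_ladderDiff (v : ℕ → ℤˣ → H) (e : ℕ) (b : ℤˣ) :
    v e b = (1 / 2 : ℂ) • (ladderSum v e + ((b : ℤ) : ℂ) • ladderDiff v e) := by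
  rcases Int.units_eq_one_or b with rfl | rfl <;> simp only [ladderSum, ladderDiff] <;>
    push_cast <;> module

namespace IsLadderFamily

variable {n : ℕ} {f : H} {v : ℕ → ℤˣ → H}

theorem sum_periodic (h : IsLadderFamily n f v) : Function.Periodic (ladderSum v) n := fun e => by
  simp only [ladderSum, h.shift, neg_neg]; exact add_comm _ _

theorem diff_antiperiodic (h : IsLadderFamily n f v) :
    Function.Antiperiodic (ladderDiff v) n := fun e => by
  simp only [ladderDiff, h.shift, neg_neg, neg_sub]

theorem rung_left (h : IsLadderFamily n f v) (e : ℕ) : inner ℂ (v e (-1)) (v e 1) = 0 := by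
  simpa using h.rung e (-1)

theorem inner_sum_self (h : IsLadderFamily n f v) (e : ℕ) :
    inner ℂ (ladderSum v e) (ladderSum v e) = inner ℂ f (ladderSum v e) := by
  simp only [ladderSum, inner_add_left, inner_add_right, h.rung, h.rung_left, h.diag, add_zero,
    zero_add]

theorem inner_base_self (h : IsLadderFamily n f v) : inner ℂ f f = 1 :=
  inner_self_eq_one_of_norm_eq_one h.norm_base

theorem inner_sum_base (h : IsLadderFamily n f v) (e : ℕ) :
    inner ℂ (ladderSum v e) f = inner ℂ f (ladderSum v e) := by
  rw [← inner_conj_symm, ← h.inner_sum_self, inner_conj_symm]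

theorem inner_diff_self (h : IsLadderFamily n f v) (e : ℕ) :
    inner ℂ (ladderDiff v e) (ladderDiff v e) = inner ℂ f (ladderSum v e) := by
  simp only [ladderSum, ladderDiff, inner_sub_left, inner_sub_right, inner_add_right, h.rung,
    h.rung_left, h.diag, sub_zero, zero_sub, sub_neg_eq_add]

theorem inner_sum_diff (h : IsLadderFamily n f v) (e : ℕ) :
    inner ℂ (ladderSum v e) (ladderDiff v e) = inner ℂ f (ladderDiff v e) := by
  simp only [ladderSum, ladderDiff, inner_add_left, inner_sub_right, h.rung, h.rung_left, h.diag,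
    add_zero, zero_add]

theorem inner_sum_succ (h : IsLadderFamily n f v) (e : ℕ) :
    inner ℂ (ladderSum v e) (ladderSum v (e + 1)) =
      inner ℂ (ladderDiff v e) (ladderDiff v (e + 1)) := by
  have hlink : inner ℂ (v e (-1)) (v (e + 1) 1) = 0 := by simpa using h.link e (-1)
  simp only [ladderSum, ladderDiff, inner_add_left, inner_sub_left, inner_add_right,
    inner_sub_right, h.link, hlink]
  ring

theorem norm_sum_sq (h : IsLadderFamily n f v) (e : ℕ) :
    ‖ladderSum v e‖ ^ 2 = inner ℝ f (ladderSum v e) := by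
  rw [real_inner_eq_re_inner ℂ, ← h.inner_sum_self, inner_self_eq_norm_sq]

theorem norm_diff_sq (h : IsLadderFamily n f v) (e : ℕ) :
    ‖ladderDiff v e‖ ^ 2 = ‖ladderSum v e‖ ^ 2 := by
  rw [h.norm_sum_sq, real_inner_eq_re_inner ℂ, ← h.inner_diff_self, inner_self_eq_norm_sq]

theorem norm_sum_add_sum_succ_sub_sq (h : IsLadderFamily n f v) (e : ℕ) (r : ℝ) :
    ‖ladderSum v e + ladderSum v (e + 1) - r • f‖ ^ 2 =
      (1 - 2 * r) * (‖ladderSum v e‖ ^ 2 + ‖ladderSum v (e + 1)‖ ^ 2) +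
        2 * inner ℝ (ladderDiff v e) (ladderDiff v (e + 1)) + r ^ 2 := by
  have hsucc : inner ℝ (ladderSum v e) (ladderSum v (e + 1)) =
      inner ℝ (ladderDiff v e) (ladderDiff v (e + 1)) := by
    rw [real_inner_eq_re_inner ℂ, real_inner_eq_re_inner ℂ, h.inner_sum_succ]
  rw [norm_sub_sq_real, norm_add_sq_real, norm_smul, h.norm_base, real_inner_smul_right,
    real_inner_comm f, inner_add_right, ← h.norm_sum_sq, ← h.norm_sum_sq, hsucc, mul_one,
    Real.norm_eq_abs, sq_abs]
  ring

theorem sum_norm_sum_add_sum_succ_sub_sq (h : IsLadderFamily n f v) (r : ℝ) :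
    ∑ e ∈ Finset.range n, ‖ladderSum v e + ladderSum v (e + 1) - r • f‖ ^ 2 =
      2 * (1 - 2 * r) * ∑ e ∈ Finset.range n, ‖ladderSum v e‖ ^ 2 +
        2 * ∑ e ∈ Finset.range n, inner ℝ (ladderDiff v e) (ladderDiff v (e + 1)) + n * r ^ 2 := by
  have hshift : ∑ e ∈ Finset.range n, ‖ladderSum v (e + 1)‖ ^ 2 =
      ∑ e ∈ Finset.range n, ‖ladderSum v e‖ ^ 2 := by
    have := Finset.sum_range_succ' (fun e => ‖ladderSum v e‖ ^ 2) n
    rw [Finset.sum_range_succ, h.sum_periodic.eq] at this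
    exact (add_right_cancel this).symm
  simp only [h.norm_sum_add_sum_succ_sub_sq, Finset.sum_add_distrib, ← Finset.mul_sum, hshift,
    Finset.sum_const, Finset.card_range, nsmul_eq_mul]
  ring

theorem sum_inner_diff_succ_le (h : IsLadderFamily n f v) (hn : n ≠ 0) :
    ∑ e ∈ Finset.range n, inner ℝ (ladderDiff v e) (ladderDiff v (e + 1)) ≤
      Real.cos (Real.pi / n) * ∑ e ∈ Finset.range n, ‖ladderSum v e‖ ^ 2 := by
  simpa only [h.norm_diff_sq] using sum_inner_succ_le hn h.diff_antiperiodic.eq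

theorem sum_norm_sum_sq_le (h : IsLadderFamily n f v) (hn : 2 ≤ n) :
    ∑ e ∈ Finset.range n, ‖ladderSum v e‖ ^ 2 ≤ n / 2 * (1 + Real.cos (Real.pi / n)) := by
  have hsquares : 0 ≤ ∑ e ∈ Finset.range n, ‖ladderSum v e + ladderSum v (e + 1) -
      (1 + Real.cos (Real.pi / n)) • f‖ ^ 2 := Finset.sum_nonneg fun _ _ => sq_nonneg _
  rw [h.sum_norm_sum_add_sum_succ_sub_sq] at hsquares
  have hpos := one_add_cos_pi_div_pos hn
  refine le_of_mul_le_mul_left (a := 2 * (1 + Real.cos (Real.pi / n))) ?_ (by positivity)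
  linear_combination hsquares + 2 * h.sum_inner_diff_succ_le (by omega)

/-- The ladder families that attain equality in `IsLadderFamily.sum_norm_sum_sq_le`. -/
structure IsExtremal (n : ℕ) (f : H) (v : ℕ → ℤˣ → H) : Prop extends IsLadderFamily n f v where
  sum_eq : ∑ e ∈ Finset.range n, ‖ladderSum v e‖ ^ 2 = n / 2 * (1 + Real.cos (Real.pi / n))

namespace IsExtremal

theorem sum_inner_diff_succ_eq (h : IsExtremal n f v) (hn : n ≠ 0) :
    ∑ e ∈ Finset.range n, inner ℝ (ladderDiff v e) (ladderDiff v (e + 1)) =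
      Real.cos (Real.pi / n) * ∑ e ∈ Finset.range n, ‖ladderSum v e‖ ^ 2 := by
  refine le_antisymm (h.sum_inner_diff_succ_le hn) ?_
  have hsquares : 0 ≤ ∑ e ∈ Finset.range n, ‖ladderSum v e + ladderSum v (e + 1) -
      (1 + Real.cos (Real.pi / n)) • f‖ ^ 2 := Finset.sum_nonneg fun _ _ => sq_nonneg _
  rw [h.sum_norm_sum_add_sum_succ_sub_sq, h.sum_eq] at hsquares
  rw [h.sum_eq]
  linear_combination hsquares / 2

theorem sum_succ (h : IsExtremal n f v) (hn : n ≠ 0) (e : ℕ) :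
    ladderSum v (e + 1) = (1 + Real.cos (Real.pi / n) : ℂ) • f - ladderSum v e := by
  have hsquares := h.sum_norm_sum_add_sum_succ_sub_sq (1 + Real.cos (Real.pi / n))
  rw [h.sum_inner_diff_succ_eq hn, h.sum_eq,
    show ∀ x : ℝ, 2 * (1 - 2 * (1 + x)) * (n / 2 * (1 + x)) + 2 * (x * (n / 2 * (1 + x))) +
      n * (1 + x) ^ 2 = 0 by intro x; ring,
    Finset.sum_eq_zero_iff_of_nonneg fun _ _ => sq_nonneg _] at hsquares
  have hperiodic : Function.Periodic (fun e => ladderSum v e + ladderSum v (e + 1)) n :=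
    fun e => by simp only [add_right_comm e n 1, h.sum_periodic _]
  have hmod := hsquares (e % n) (Finset.mem_range.2 (Nat.mod_lt _ (by omega)))
  rw [sq_eq_zero_iff, norm_eq_zero, sub_eq_zero, hperiodic.map_mod_nat] at hmod
  rw [eq_sub_iff_add_eq', hmod, ← Complex.coe_smul, Complex.ofReal_add, Complex.ofReal_one]

theorem sum_add_two (h : IsExtremal n f v) (hn : n ≠ 0) (e : ℕ) :
    ladderSum v (e + 2) = ladderSum v e := by
  rw [h.sum_succ hn, h.sum_succ hn, sub_sub_cancel]

theorem diff_add_two (h : IsExtremal n f v) (hn : n ≠ 0) (e : ℕ) :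
    ladderDiff v (e + 2) =
      (2 * Real.cos (Real.pi / n) : ℂ) • ladderDiff v (e + 1) - ladderDiff v e := by
  rw [eq_sub_iff_add_eq', add_add_two_eq_smul_of_sum_inner_succ_eq hn h.diff_antiperiodic
    (by simpa only [h.norm_diff_sq] using h.sum_inner_diff_succ_eq hn), ← Complex.coe_smul,
    Complex.ofReal_mul, Complex.ofReal_ofNat]

theorem add_two (h : IsExtremal n f v) (hn : n ≠ 0) (e : ℕ) (b : ℤˣ) :
    v (e + 2) b =
      v e (-b) + (Real.cos (Real.pi / n) : ℂ) • (v (e + 1) b - v (e + 1) (-b)) := by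
  rw [eq_ladderSum_add_ladderDiff v (e + 2), eq_ladderSum_add_ladderDiff v e,
    eq_ladderSum_add_ladderDiff v (e + 1) b, eq_ladderSum_add_ladderDiff v (e + 1) (-b),
    h.sum_add_two hn, h.diff_add_two hn]
  push_cast
  module

theorem inner_base_sum (h : IsExtremal n f v) (hn : 3 ≤ n) (e : ℕ) :
    inner ℂ f (ladderSum v e) = ((1 + Real.cos (Real.pi / n)) / 2 : ℂ) := by
  have hc : (Real.cos (Real.pi / n) : ℂ) ≠ 0 := Complex.ofReal_ne_zero.2 (cos_pi_div_pos hn).ne'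
  have hsucc := h.sum_succ (by omega) e
  have hadd := congrArg (inner ℂ f) hsucc
  have hleft := congrArg (inner ℂ (ladderSum v e)) hsucc
  have hright := congrArg (fun x => inner ℂ x (ladderSum v (e + 1))) hsucc
  simp only [inner_sub_left, inner_sub_right, inner_smul_left, inner_smul_right, map_add, map_one,
    Complex.conj_ofReal, h.inner_sum_self, h.inner_sum_base, h.inner_base_self] at hadd hleft hright
  have hconst : inner ℂ f (ladderSum v e) = inner ℂ f (ladderSum v (e + 1)) :=
    mul_left_cancel₀ hc (by linear_combination hright - hleft)
  linear_combination hadd / 2 + hconst / 2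

theorem inner_sum_sum (h : IsExtremal n f v) (hn : 3 ≤ n) (e k : ℕ) :
    inner ℂ (ladderSum v e) (ladderSum v (e + k)) = ((1 + Real.cos (Real.pi / n)) / 4 *
      (1 + Real.cos (Real.pi / n) + (-1) ^ k * (1 - Real.cos (Real.pi / n))) : ℂ) := by
  induction k with
  | zero => rw [add_zero, h.inner_sum_self, h.inner_base_sum hn]; ring
  | succ k ih =>
    rw [← add_assoc, h.sum_succ (by omega), inner_sub_right, inner_smul_right, h.inner_sum_base,
      h.inner_base_sum hn, ih]
    ring

theorem inner_base_diff (h : IsExtremal n f v) (hn : 3 ≤ n) (e : ℕ) :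
    inner ℂ f (ladderDiff v e) = 0 := by
  have hc : (Real.cos (Real.pi / n) : ℂ) ≠ 0 := Complex.ofReal_ne_zero.2 (cos_pi_div_pos hn).ne'
  have hc1 : (1 - Real.cos (Real.pi / n) : ℂ) ≠ 0 := by
    exact_mod_cast (sub_pos.2 (cos_pi_div_lt_one (n := n) (by omega))).ne'
  have hnext : ∀ e, inner ℂ (ladderSum v (e + 1)) (ladderDiff v e) =
      (Real.cos (Real.pi / n) : ℂ) * inner ℂ f (ladderDiff v e) := fun e => by
    rw [h.sum_succ (by omega), inner_sub_left, inner_smul_left, h.inner_sum_diff, map_add, map_one,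
      Complex.conj_ofReal]
    ring
  have hprev : ∀ e, inner ℂ (ladderSum v e) (ladderDiff v (e + 1)) =
      (Real.cos (Real.pi / n) : ℂ) * inner ℂ f (ladderDiff v (e + 1)) := fun e => by
    rw [← hnext, h.sum_add_two (by omega)]
  have hsucc : ∀ e, inner ℂ f (ladderDiff v (e + 1)) = 0 := fun e => by
    have hbase := congrArg (inner ℂ f) (h.diff_add_two (by omega) e)
    have hsum := congrArg (inner ℂ (ladderSum v (e + 1))) (h.diff_add_two (by omega) e)
    simp only [inner_sub_right, inner_smul_right, h.inner_sum_diff, hnext, hprev] at hbase hsum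
    refine mul_left_cancel₀ (mul_ne_zero hc hc1) ?_
    linear_combination ((Real.cos (Real.pi / n) : ℂ) * hbase - hsum) / 2
  obtain ⟨k, hk⟩ : ∃ k, e + n = k + 1 := ⟨e + n - 1, by omega⟩
  rw [← neg_eq_zero, ← inner_neg_right, ← h.diff_antiperiodic, hk, hsucc]

theorem inner_sum_diff_eq_zero (h : IsExtremal n f v) (hn : 3 ≤ n) (e e' : ℕ) :
    inner ℂ (ladderSum v e) (ladderDiff v e') = 0 := by
  have halternate : ∀ k, inner ℂ (ladderSum v k) (ladderDiff v e') =
      (-1) ^ k * inner ℂ (ladderSum v 0) (ladderDiff v e') := fun k => by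
    induction k with
    | zero => rw [pow_zero, one_mul]
    | succ k ih =>
      rw [h.sum_succ (by omega), inner_sub_left, inner_smul_left, h.inner_base_diff hn, ih,
        pow_succ]
      ring
  have hzero := h.inner_sum_diff e'
  rw [halternate, h.inner_base_diff hn] at hzero
  rw [halternate, (mul_eq_zero.1 hzero).resolve_left (pow_ne_zero _ (neg_ne_zero.2 one_ne_zero)),
    mul_zero]

theorem inner_diff_diff (h : IsExtremal n f v) (hn : 3 ≤ n) (e k : ℕ) :
    inner ℂ (ladderDiff v e) (ladderDiff v (e + k)) =
      ((1 + Real.cos (Real.pi / n)) / 2 * Real.cos (k * (Real.pi / n)) : ℂ) := by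
  induction k using Nat.twoStepInduction with
  | zero => rw [add_zero, h.inner_diff_self, h.inner_base_sum hn]; simp
  | one => rw [← h.inner_sum_succ, h.inner_sum_sum hn, Nat.cast_one, one_mul]; ring
  | more k ih ih' =>
    have hcos : Real.cos ((k + 2 : ℕ) * (Real.pi / n)) =
        2 * Real.cos (Real.pi / n) * Real.cos ((k + 1 : ℕ) * (Real.pi / n)) -
          Real.cos (k * (Real.pi / n)) := by
      push_cast
      rw [eq_sub_iff_add_eq, Real.cos_add_cos]
      ring_nf
    rw [← add_assoc, h.diff_add_two (by omega), inner_sub_right, inner_smul_right, add_assoc, ih,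
      ih', hcos]
    push_cast
    ring

theorem inner_add (h : IsExtremal n f v) (hn : 3 ≤ n) (e k : ℕ) (b b' : ℤˣ) :
    inner ℂ (v e b) (v (e + k) b') = (((1 + Real.cos (Real.pi / n)) / 16 *
      (1 + Real.cos (Real.pi / n) + (-1) ^ k * (1 - Real.cos (Real.pi / n)) +
        2 * (b * b' : ℤˣ) * Real.cos (k * (Real.pi / n))) : ℝ) : ℂ) := by
  have hdiff_sum : inner ℂ (ladderDiff v e) (ladderSum v (e + k)) = 0 := by
    rw [← inner_conj_symm, h.inner_sum_diff_eq_zero hn, map_zero]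
  rw [eq_ladderSum_add_ladderDiff v e b, eq_ladderSum_add_ladderDiff v (e + k) b']
  simp only [inner_smul_left, inner_smul_right, inner_add_left, inner_add_right,
    h.inner_sum_sum hn, h.inner_diff_diff hn, h.inner_sum_diff_eq_zero hn, hdiff_sum,
    map_div₀, map_one, map_ofNat, map_intCast]
  push_cast
  ring

theorem inner_base (h : IsExtremal n f v) (hn : 3 ≤ n) (e : ℕ) (b : ℤˣ) :
    inner ℂ f (v e b) = (((1 + Real.cos (Real.pi / n)) / 4 : ℝ) : ℂ) := by
  rw [eq_ladderSum_add_ladderDiff v e b, inner_smul_right, inner_add_right, inner_smul_right,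
    h.inner_base_sum hn, h.inner_base_diff hn]
  push_cast
  ring

theorem inner_eq_inner {H' : Type*} [NormedAddCommGroup H'] [InnerProductSpace ℂ H'] {f' : H'}
    {v' : ℕ → ℤˣ → H'} (h : IsExtremal n f v) (h' : IsExtremal n f' v') (hn : 3 ≤ n)
    (e e' : ℕ) (b b' : ℤˣ) : inner ℂ (v e b) (v e' b') = inner ℂ (v' e b) (v' e' b') := by
  rcases le_total e e' with hle | hle <;> obtain ⟨k, rfl⟩ := Nat.exists_eq_add_of_le hle
  · rw [h.inner_add hn, h'.inner_add hn]
  · rw [← inner_conj_symm, h.inner_add hn, ← h'.inner_add hn, inner_conj_symm]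

theorem norm_eq (h : IsExtremal n f v) (hn : 3 ≤ n) (e : ℕ) (b : ℤˣ) :
    ‖v e b‖ = √(1 + Real.cos (Real.pi / n)) / 2 := by
  have hpos := one_add_cos_pi_div_pos (n := n) (by omega)
  rw [← sq_eq_sq₀ (norm_nonneg _) (by positivity), div_pow, Real.sq_sqrt hpos.le,
    ← inner_self_eq_norm_sq (𝕜 := ℂ), h.diag, h.inner_base hn,
    RCLike.re_eq_complex_re, Complex.ofReal_re]
  ring

end IsExtremal

end IsLadderFamily

end Ladder

/-! ### The exclusivity graph is a Möbius ladder -/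

theorem sum_units_int {M : Type*} [AddCommMonoid M] (g : ℤˣ → M) :
    ∑ b, g b = g 1 + g (-1) := by
  rw [show (Finset.univ : Finset ℤˣ) = {1, -1} by decide]
  exact Finset.sum_pair (by decide)

theorem units_neg_one_pow_eq_iff (m m' : ℕ) : (-1 : ℤˣ) ^ m = (-1) ^ m' ↔ m % 2 = m' % 2 := by
  rw [Int.units_pow_eq_pow_mod_two, Int.units_pow_eq_pow_mod_two (-1) m']
  rcases Nat.mod_two_eq_zero_or_one m with h | h <;>
    rcases Nat.mod_two_eq_zero_or_one m' with h' | h' <;> rw [h, h'] <;> decide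

theorem natCast_sub_eq_natCast_iff {M k k' d : ℕ} (hk : k < M) (hk' : k' < M) (hd : d < M) :
    (k : ZMod M) - k' = d ↔ k = k' + d ∨ k + M = k' + d := by
  rw [sub_eq_iff_eq_add, ← Nat.cast_add, ZMod.natCast_eq_natCast_iff, Nat.ModEq,
    Nat.mod_eq_of_lt hk, add_comm d k']
  rcases Nat.lt_or_ge (k' + d) M with h | h
  · rw [Nat.mod_eq_of_lt h]; omega
  · rw [Nat.mod_eq_sub_mod h, Nat.mod_eq_of_lt (by omega)]; omega

theorem circulantGraph_adj_natCast {N : ℕ} (hN : 2 ≤ N) {k k' : ℕ} (hk : k < 4 * N)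
    (hk' : k' < 4 * N) :
    (SimpleGraph.circulantGraph ({1, ((2 * N : ℕ) : ZMod (4 * N))} : Set (ZMod (4 * N)))).Adj
        k k' ↔
      (k + 1 = k' ∨ k' + 1 = k ∨ k + 1 = k' + 4 * N ∨ k' + 1 = k + 4 * N) ∨
        k + 2 * N = k' ∨ k' + 2 * N = k := by
  rw [← Nat.cast_one (R := ZMod (4 * N)), SimpleGraph.circulantGraph, SimpleGraph.fromRel_adj]
  simp only [Set.mem_insert_iff, Set.mem_singleton_iff]
  rw [natCast_sub_eq_natCast_iff hk hk' (by omega), natCast_sub_eq_natCast_iff hk hk' (by omega),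
    natCast_sub_eq_natCast_iff hk' hk (by omega), natCast_sub_eq_natCast_iff hk' hk (by omega),
    Ne, ZMod.natCast_eq_natCast_iff, Nat.ModEq, Nat.mod_eq_of_lt hk, Nat.mod_eq_of_lt hk']
  omega

section MobiusLadder

variable {N : ℕ} [NeZero N]

/-- The event of the `e`-th rung of the ladder in which Bob obtains `b`, up to the sign that makes
the numbering of the rungs by `ℕ` exchange the outcomes after each turn around the ladder. -/
def ladderEvent (N : ℕ) [NeZero N] (e : ℕ) (b : ℤˣ) : ChainEvent N :=
  let r : Fin (2 * N) := ⟨e % (2 * N), Nat.mod_lt _ (by have := NeZero.pos N; omega)⟩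
  (r, chainSign r * ((-1) ^ (e / (2 * N)) * b))

theorem chainB_ladderEvent (e : ℕ) (b : ℤˣ) :
    chainB (ladderEvent N e b).1 = Fin.ofNat N (e / 2) :=
  Fin.ext (Nat.mod_mul_right_div_self e 2 N)

theorem outB_ladderEvent (e : ℕ) (b : ℤˣ) :
    (ladderEvent N e b).outB = (-1) ^ (e / 2 / N) * b := by
  rw [Nat.div_div_eq_div_mul, ChainEvent.outB, ladderEvent, ← mul_assoc, Int.units_mul_self,
    one_mul]

theorem chainA_ladderEvent (e : ℕ) (b : ℤˣ) :
    chainA (ladderEvent N e b).1 = Fin.ofNat N ((e + 1) / 2) := by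
  refine Fin.ext ?_
  simp only [chainA, ladderEvent, Fin.val_ofNat]
  conv_rhs => rw [← Nat.mod_add_div e (2 * N), mul_assoc, add_right_comm,
    Nat.add_mul_div_left _ _ two_pos, Nat.add_mul_mod_self_left]

theorem snd_ladderEvent (e : ℕ) (b : ℤˣ) :
    (ladderEvent N e b).2 = (-1) ^ ((e + 1) / 2 / N) * b := by
  have hN := NeZero.pos N
  have hturns : (e + 1) / 2 / N = (e % (2 * N) + 1) / 2 / N + e / (2 * N) := by
    conv_lhs => rw [← Nat.mod_add_div e (2 * N), mul_assoc, add_right_comm,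
      Nat.add_mul_div_left _ _ two_pos, Nat.add_mul_div_left _ _ hN]
  have hmod := Nat.mod_lt e (show 0 < 2 * N by omega)
  have hsign : (-1 : ℤˣ) ^ ((e % (2 * N) + 1) / 2 / N) =
      if e % (2 * N) + 1 = 2 * N then -1 else 1 := by
    split_ifs with hlast
    · rw [hlast, Nat.mul_div_cancel_left _ two_pos, Nat.div_self hN, pow_one]
    · rw [Nat.div_eq_of_lt (by omega), pow_zero]
  rw [hturns, pow_add, hsign, mul_assoc]
  rfl

theorem ladderEvent_add (e : ℕ) (b : ℤˣ) :
    ladderEvent N (e + 2 * N) b = ladderEvent N e (-b) := by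
  have hdiv : (e + 2 * N) / (2 * N) = e / (2 * N) + 1 :=
    Nat.add_div_right _ (by have := NeZero.pos N; omega)
  simp only [ladderEvent, Nat.add_mod_right, hdiv, pow_succ, mul_neg, mul_one, neg_mul]

theorem ladderEvent_val (e : Fin (2 * N)) (b : ℤˣ) : ladderEvent N e b = (e, chainSign e * b) := by
  have hmod : (e : ℕ) % (2 * N) = e := Nat.mod_eq_of_lt e.isLt
  have hdiv : (e : ℕ) / (2 * N) = 0 := Nat.div_eq_of_lt e.isLt
  simp only [ladderEvent, hmod, hdiv, pow_zero, one_mul, Fin.eta]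

theorem ladderEvent_outB (i : ChainEvent N) : ladderEvent N i.1 i.outB = i := by
  rw [ladderEvent_val, ChainEvent.outB, ← mul_assoc, Int.units_mul_self, one_mul]

theorem sum_chainEvent {M : Type*} [AddCommMonoid M] (g : ChainEvent N → M) :
    ∑ i, g i =
      ∑ e ∈ Finset.range (2 * N), (g (ladderEvent N e 1) + g (ladderEvent N e (-1))) := by
  rw [Fintype.sum_prod_type, Finset.sum_range]
  refine Finset.sum_congr rfl fun e _ => ?_
  rw [ladderEvent_val, ladderEvent_val, ← sum_units_int fun b => g (e, chainSign e * b)]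
  exact (Equiv.sum_comp (Equiv.mulLeft (chainSign e)) fun b => g (e, b)).symm

theorem chainedExclusivityGraph_adj_ladderEvent {e e' : ℕ} {b b' : ℤˣ} :
    (chainedExclusivityGraph N).Adj (ladderEvent N e b) (ladderEvent N e' b') ↔
      ((e + 1) / 2 % N = (e' + 1) / 2 % N ∧
        (-1) ^ ((e + 1) / 2 / N) * b ≠ (-1) ^ ((e' + 1) / 2 / N) * b') ∨
      (e / 2 % N = e' / 2 % N ∧ (-1) ^ (e / 2 / N) * b ≠ (-1) ^ (e' / 2 / N) * b') := by
  simp only [chainedExclusivityGraph, chainA_ladderEvent, chainB_ladderEvent, snd_ladderEvent,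
    outB_ladderEvent, Fin.ext_iff, Fin.val_ofNat]

theorem adj_ladderEvent_neg (e : ℕ) (b : ℤˣ) :
    (chainedExclusivityGraph N).Adj (ladderEvent N e b) (ladderEvent N e (-b)) :=
  chainedExclusivityGraph_adj_ladderEvent.2
    (.inr ⟨rfl, fun h => units_ne_neg_self b (mul_left_cancel h)⟩)

theorem adj_ladderEvent_succ (e : ℕ) (b : ℤˣ) :
    (chainedExclusivityGraph N).Adj (ladderEvent N e b) (ladderEvent N (e + 1) (-b)) := by
  have hne : ∀ k, (-1) ^ k * b ≠ (-1) ^ k * -b :=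
    fun k h => units_ne_neg_self b (mul_left_cancel h)
  rw [chainedExclusivityGraph_adj_ladderEvent]
  rcases Nat.even_or_odd' e with ⟨k, rfl | rfl⟩
  · rw [show (2 * k + 1) / 2 = 2 * k / 2 by omega]
    exact .inr ⟨rfl, hne _⟩
  · rw [show (2 * k + 1 + 1 + 1) / 2 = (2 * k + 1 + 1) / 2 by omega]
    exact .inl ⟨rfl, hne _⟩

theorem mod_eq_and_parity_ne_iff {m m' k k' : ℕ} (hm : m ≤ 2 * N) (hm' : m' ≤ 2 * N) :
    (m % N = m' % N ∧ (m / N + k) % 2 ≠ (m' / N + k') % 2) ↔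
      ((m = m' ∨ m + 2 * N = m' ∨ m' + 2 * N = m) ∧ k % 2 ≠ k' % 2) ∨
        ((m + N = m' ∨ m' + N = m) ∧ k % 2 = k' % 2) := by
  have hN := NeZero.pos N
  have hcases : ∀ m ≤ 2 * N, (m / N = 0 ∧ m % N = m ∧ m < N) ∨
      (m / N = 1 ∧ m = N + m % N ∧ m % N < N) ∨ (m / N = 2 ∧ m % N = 0 ∧ m = 2 * N) := by
    intro m hm
    have hlt := Nat.mod_lt m hN
    have hdecomp := Nat.mod_add_div m N
    have hq : m / N ≤ 2 := Nat.div_le_of_le_mul (by rwa [mul_comm])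
    interval_cases m / N <;> omega
  rcases hcases m hm with h | h | h <;> rcases hcases m' hm' with h' | h' | h' <;>
    rw [h.1, h'.1] <;> omega

theorem chainedExclusivityGraph_adj_ladderEvent_pow (hN : 2 ≤ N) {k k' : ℕ} (hk : k < 4 * N)
    (hk' : k' < 4 * N) :
    (chainedExclusivityGraph N).Adj (ladderEvent N k ((-1) ^ k)) (ladderEvent N k' ((-1) ^ k')) ↔
      (k + 1 = k' ∨ k' + 1 = k ∨ k + 1 = k' + 4 * N ∨ k' + 1 = k + 4 * N) ∨
        k + 2 * N = k' ∨ k' + 2 * N = k := by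
  rw [chainedExclusivityGraph_adj_ladderEvent]
  simp only [← pow_add, Ne, units_neg_one_pow_eq_iff]
  rw [← Ne, ← Ne, mod_eq_and_parity_ne_iff (by omega) (by omega),
    mod_eq_and_parity_ne_iff (by omega) (by omega)]
  omega

theorem exists_eq_ladderEvent_pow (i : ChainEvent N) :
    ∃ k < 4 * N, ladderEvent N k ((-1) ^ k) = i := by
  have hlt := i.1.isLt
  by_cases hout : i.outB = (-1) ^ (i.1 : ℕ)
  · exact ⟨i.1, by omega, by rw [← hout, ladderEvent_outB]⟩
  · refine ⟨i.1 + 2 * N, by omega, ?_⟩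
    rw [ladderEvent_add, pow_add, pow_mul, neg_one_sq, one_pow, mul_one,
      ← Int.units_ne_iff_eq_neg.1 hout, ladderEvent_outB]

theorem nonempty_chainedExclusivityGraph_iso_circulantGraph (hN : 2 ≤ N) :
    Nonempty (chainedExclusivityGraph N ≃g
      SimpleGraph.circulantGraph ({1, ((2 * N : ℕ) : ZMod (4 * N))} : Set (ZMod (4 * N)))) := by
  have : NeZero (4 * N) := ⟨by omega⟩
  have hsurjective :
      Function.Surjective fun z : ZMod (4 * N) => ladderEvent N z.val ((-1) ^ z.val) := fun i => by
    obtain ⟨k, hk, rfl⟩ := exists_eq_ladderEvent_pow i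
    exact ⟨k, by simp only [ZMod.val_cast_of_lt hk]⟩
  have hcard : Fintype.card (ZMod (4 * N)) = Fintype.card (ChainEvent N) := by
    rw [ZMod.card, Fintype.card_prod, Fintype.card_fin, Fintype.card_units_int]
    ring
  have hbijective := (Fintype.bijective_iff_surjective_and_card _).2 ⟨hsurjective, hcard⟩
  refine ⟨RelIso.symm ⟨Equiv.ofBijective _ hbijective, fun {z z'} => ?_⟩⟩
  rw [Equiv.ofBijective_apply, Equiv.ofBijective_apply,
    chainedExclusivityGraph_adj_ladderEvent_pow hN z.val_lt z'.val_lt,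
    ← circulantGraph_adj_natCast hN z.val_lt z'.val_lt, ZMod.natCast_zmod_val,
    ZMod.natCast_zmod_val]

end MobiusLadder

/-! ### The theta program of the Möbius ladder -/

theorem exists_eq_transpose_gram_of_posSemidef {𝕜 ι : Type*} [RCLike 𝕜] [Finite ι]
    {X : Matrix ι ι 𝕜} (hX : X.PosSemidef) :
    ∃ (m : ℕ) (w : ι → EuclideanSpace 𝕜 (Fin m)), X = (Matrix.gram 𝕜 w).transpose := by
  obtain ⟨m, x, rfl⟩ := Matrix.posSemidef_iff_eq_sum_vecMulVec.1 hX
  refine ⟨m, fun i => WithLp.toLp 2 fun k => x k i, ?_⟩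
  ext i j
  simp [Matrix.sum_apply, Matrix.vecMulVec_apply, PiLp.inner_apply]

section ThetaFamily

variable {V : Type*} {H : Type*} [NormedAddCommGroup H] [InnerProductSpace ℂ H]

/-- A family of vectors whose (transposed) Gram matrix is feasible for the theta program of `G`;
the vector at `none` is the one of the extra index `0`. -/
structure IsThetaFamily (G : SimpleGraph V) (w : Option V → H) : Prop where
  norm_none : ‖w none‖ = 1
  diag : ∀ i, inner ℂ (w (some i)) (w (some i)) = inner ℂ (w none) (w (some i))
  edge : ∀ i j, G.Adj i j → inner ℂ (w (some i)) (w (some j)) = 0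

theorem thetaFeasible_transpose_gram_iff [Finite V] {G : SimpleGraph V} {w : Option V → H} :
    ThetaFeasible G (Matrix.gram ℂ w).transpose ↔ IsThetaFamily G w := by
  have hdiag : ∀ i, inner ℂ (w (some i)) (w (some i)) = inner ℂ (w (some i)) (w none) ↔
      inner ℂ (w (some i)) (w (some i)) = inner ℂ (w none) (w (some i)) := fun i =>
    (starRingEnd ℂ).injective.eq_iff.symm.trans (by rw [inner_conj_symm, inner_conj_symm])
  have hnorm : inner ℂ (w none) (w none) = 1 ↔ ‖w none‖ = 1 := by
    rw [inner_self_eq_norm_sq_to_K, ← RCLike.ofReal_pow, ← RCLike.ofReal_one (K := ℂ),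
      RCLike.ofReal_inj, pow_eq_one_iff_of_nonneg (norm_nonneg _) two_ne_zero]
  constructor
  · exact fun h => ⟨hnorm.1 h.corner, fun i => (hdiag i).1 (h.diag i),
      fun i j hij => h.edge j i hij.symm⟩
  · exact fun h => ⟨(Matrix.posSemidef_gram ℂ w).transpose, hnorm.2 h.norm_none,
      fun i => (hdiag i).2 (h.diag i), fun i j hij => h.edge j i hij.symm⟩

variable {N : ℕ} [NeZero N]

namespace IsThetaFamily

variable {w : Option (ChainEvent N) → H}

theorem isLadderFamily (h : IsThetaFamily (chainedExclusivityGraph N) w) :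
    IsLadderFamily (2 * N) (w none) fun e b => w (some (ladderEvent N e b)) where
  norm_base := h.norm_none
  shift e b := by rw [ladderEvent_add]
  diag e b := h.diag _
  rung e b := h.edge _ _ (adj_ladderEvent_neg e b)
  link e b := h.edge _ _ (adj_ladderEvent_succ e b)

theorem thetaObjective_eq (h : IsThetaFamily (chainedExclusivityGraph N) w) :
    thetaObjective (Matrix.gram ℂ w).transpose = ∑ e ∈ Finset.range (2 * N),
      ‖ladderSum (fun e b => w (some (ladderEvent N e b))) e‖ ^ 2 := by
  rw [thetaObjective, sum_chainEvent]
  refine Finset.sum_congr rfl fun e _ => ?_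
  rw [← inner_self_eq_norm_sq (𝕜 := ℂ), h.isLadderFamily.inner_sum_self, ladderSum,
    inner_add_right, ← h.diag, ← h.diag]
  rfl

theorem isExtremal (h : IsThetaFamily (chainedExclusivityGraph N) w)
    (hval : thetaObjective (Matrix.gram ℂ w).transpose =
      N * (1 + Real.cos (Real.pi / (2 * N)))) :
    IsLadderFamily.IsExtremal (2 * N) (w none) fun e b => w (some (ladderEvent N e b)) := by
  refine ⟨h.isLadderFamily, ?_⟩
  rw [← h.thetaObjective_eq, hval]
  push_cast
  ring

end IsThetaFamily

namespace ThetaFeasible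

variable {X Y : Matrix (Option (ChainEvent N)) (Option (ChainEvent N)) ℂ}

theorem thetaObjective_le (h : ThetaFeasible (chainedExclusivityGraph N) X) :
    thetaObjective X ≤ N * (1 + Real.cos (Real.pi / (2 * N))) := by
  obtain ⟨m, w, rfl⟩ := exists_eq_transpose_gram_of_posSemidef h.posSemidef
  have hw := thetaFeasible_transpose_gram_iff.1 h
  rw [hw.thetaObjective_eq]
  refine (hw.isLadderFamily.sum_norm_sum_sq_le (by have := NeZero.pos N; omega)).trans_eq ?_
  push_cast
  ring

theorem eq_of_thetaObjective_eq (hN : 2 ≤ N)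
    (hX : ThetaFeasible (chainedExclusivityGraph N) X)
    (hXval : thetaObjective X = N * (1 + Real.cos (Real.pi / (2 * N))))
    (hY : ThetaFeasible (chainedExclusivityGraph N) Y)
    (hYval : thetaObjective Y = N * (1 + Real.cos (Real.pi / (2 * N)))) : X = Y := by
  have hsome : ∀ i j, X (some i) (some j) = Y (some i) (some j) := fun i j => by
    obtain ⟨m, w, rfl⟩ := exists_eq_transpose_gram_of_posSemidef hX.posSemidef
    obtain ⟨m', w', rfl⟩ := exists_eq_transpose_gram_of_posSemidef hY.posSemidef
    have hw := (thetaFeasible_transpose_gram_iff.1 hX).isExtremal hXval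
    have hw' := (thetaFeasible_transpose_gram_iff.1 hY).isExtremal hYval
    simpa only [ladderEvent_outB, Matrix.transpose_apply, Matrix.gram_apply] using
      hw.inner_eq_inner hw' (by omega) j.1 i.1 j.outB i.outB
  have hnone : ∀ i, X none (some i) = Y none (some i) := fun i => by
    rw [← hX.diag, ← hY.diag, hsome]
  ext (_ | i) (_ | j)
  · rw [hX.corner, hY.corner]
  · exact hnone j
  · rw [← hX.posSemidef.1.apply, ← hY.posSemidef.1.apply, hnone]
  · exact hsome i j

end ThetaFeasible

end ThetaFamily

/-! ### The matrix of a realization -/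

theorem isSymmetric_tensorProduct_map {𝕜 E F : Type*} [RCLike 𝕜] [NormedAddCommGroup E]
    [InnerProductSpace 𝕜 E] [NormedAddCommGroup F] [InnerProductSpace 𝕜 F] {f : E →ₗ[𝕜] E}
    {g : F →ₗ[𝕜] F} (hf : f.IsSymmetric) (hg : g.IsSymmetric) :
    (TensorProduct.map f g).IsSymmetric := fun x y => by
  induction x with
  | zero => simp
  | add x x' hx hx' => rw [map_add, inner_add_left, inner_add_left, hx, hx']
  | tmul a b =>
    induction y with
    | zero => simp
    | add y y' hy hy' => rw [map_add, inner_add_right, inner_add_right, hy, hy']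
    | tmul a' b' => simp [hf a a', hg b b']

theorem mul_eq_zero_of_sum_units_int_eq_one {R : Type*} [Ring R] {p : ℤˣ → R}
    (hp : ∀ a, IsIdempotentElem (p a)) (hsum : ∑ a, p a = 1) {a a' : ℤˣ} (ha : a ≠ a') :
    p a * p a' = 0 := by
  have hcompl : p a' = 1 - p a := by
    rw [eq_sub_iff_add_eq', ← hsum, sum_units_int, Int.units_ne_iff_eq_neg.1 ha]
    rcases Int.units_eq_one_or a' with rfl | rfl
    · exact add_comm _ _
    · rw [neg_neg]
  rw [hcompl, (hp a).mul_one_sub_self]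

namespace BellRealization

variable {N : ℕ} {HA HB : Type*} [NormedAddCommGroup HA] [InnerProductSpace ℂ HA]
  [NormedAddCommGroup HB] [InnerProductSpace ℂ HB]

section Projections

variable (S : BellRealization N HA HB)

theorem inner_eventVec_eventVec (x y x' y' : Fin N) (a b a' b' : ℤˣ) :
    inner ℂ (S.eventVec x y a b) (S.eventVec x' y' a' b') =
      inner ℂ S.state (TensorProduct.map (S.projA x a * S.projA x' a')
        (S.projB y b * S.projB y' b') S.state) := by
  rw [eventVec, isSymmetric_tensorProduct_map (S.projA_isProj x a).isSymmetric
    (S.projB_isProj y b).isSymmetric, TensorProduct.map_mul, Module.End.mul_apply, eventVec]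

theorem inner_eventVec_self (x y : Fin N) (a b : ℤˣ) :
    inner ℂ (S.eventVec x y a b) (S.eventVec x y a b) =
      inner ℂ S.state (S.eventVec x y a b) := by
  rw [inner_eventVec_eventVec, (S.projA_isProj x a).isIdempotentElem,
    (S.projB_isProj y b).isIdempotentElem, eventVec]

end Projections

namespace IsMeasurement

variable {S : BellRealization N HA HB}

theorem isThetaFamily (h : S.IsMeasurement) :
    IsThetaFamily (chainedExclusivityGraph N) (chainedVec S) where
  norm_none := S.norm_state
  diag _ := S.inner_eventVec_self _ _ _ _
  edge i j hij := by
    rw [chainedVec, chainedVec, inner_eventVec_eventVec]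
    rcases hij with ⟨hsetting, houtcome⟩ | ⟨hsetting, houtcome⟩
    · rw [hsetting, mul_eq_zero_of_sum_units_int_eq_one
        (fun a => (S.projA_isProj _ a).isIdempotentElem) (h.1 _) houtcome,
        TensorProduct.map_zero_left, LinearMap.zero_apply, inner_zero_right]
    · rw [hsetting, mul_eq_zero_of_sum_units_int_eq_one
        (fun b => (S.projB_isProj _ b).isIdempotentElem) (h.2 _) houtcome,
        TensorProduct.map_zero_right, LinearMap.zero_apply, inner_zero_right]

theorem thetaFeasible (h : S.IsMeasurement) :
    ThetaFeasible (chainedExclusivityGraph N) (chainedGram S) :=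
  thetaFeasible_transpose_gram_iff.2 h.isThetaFamily

theorem sum_eventVec (h : S.IsMeasurement) (x y : Fin N) :
    ∑ a, ∑ b, S.eventVec x y a b = S.state := by
  have hid : TensorProduct.map (∑ a, S.projA x a) (∑ b, S.projB y b) S.state = S.state := by
    rw [h.1, h.2, TensorProduct.map_id, LinearMap.id_apply]
  rw [sum_units_int, sum_units_int, TensorProduct.map_add_left, TensorProduct.map_add_right,
    TensorProduct.map_add_right] at hid
  simp only [sum_units_int]
  exact hid

theorem sum_prob (h : S.IsMeasurement) (x y : Fin N) : ∑ a, ∑ b, S.prob x y a b = 1 := by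
  have hinner : inner ℂ S.state (∑ a, ∑ b, S.eventVec x y a b) = 1 := by
    rw [h.sum_eventVec, inner_self_eq_one_of_norm_eq_one S.norm_state]
  simpa only [inner_sum, Complex.re_sum, Complex.one_re, prob] using congrArg Complex.re hinner

theorem sum_prob_mul (h : S.IsMeasurement) (x y : Fin N) (s : ℤˣ) :
    ∑ a, S.prob x y a (s * a) = (1 + ((s : ℤ) : ℝ) * S.correlator x y) / 2 := by
  have hsum := h.sum_prob x y
  rw [correlator]
  simp only [sum_units_int] at hsum ⊢
  rcases Int.units_eq_one_or s with rfl | rfl <;> simp <;> linarith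

theorem thetaObjective_eq (h : S.IsMeasurement) :
    thetaObjective (chainedGram S) = N + chainedBell S / 2 := by
  have hterm : ∀ e, ∑ a, (chainedGram S (some (e, a)) (some (e, a))).re =
      1 / 2 + ((chainSign e : ℤ) : ℝ) * S.correlator (chainA e) (chainB e) / 2 := fun e => by
    rw [← add_div, ← h.sum_prob_mul]
    exact Finset.sum_congr rfl fun a _ => congrArg Complex.re (S.inner_eventVec_self _ _ _ _)
  rw [thetaObjective, chainedBell, Fintype.sum_prod_type, Finset.sum_congr rfl fun e _ => hterm e,
    Finset.sum_add_distrib, Finset.sum_const, Finset.card_univ, Fintype.card_fin, nsmul_eq_mul,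
    ← Finset.sum_div]
  push_cast
  ring

end IsMeasurement

end BellRealization

/-! ### Rank-one projections -/

section RankOne

variable {𝕜 E F : Type*} [RCLike 𝕜] [NormedAddCommGroup E] [InnerProductSpace 𝕜 E]
  [NormedAddCommGroup F] [InnerProductSpace 𝕜 F]

theorem tensorProduct_map_rankOne {E' F' : Type*} [NormedAddCommGroup E']
    [InnerProductSpace 𝕜 E'] [NormedAddCommGroup F'] [InnerProductSpace 𝕜 F'] (x : E) (y : F)
    (x' : E') (y' : F') :
    TensorProduct.map (InnerProductSpace.rankOne 𝕜 x x').toLinearMap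
        (InnerProductSpace.rankOne 𝕜 y y').toLinearMap =
      (InnerProductSpace.rankOne 𝕜 (x ⊗ₜ[𝕜] y) (x' ⊗ₜ[𝕜] y')).toLinearMap :=
  TensorProduct.ext' fun u w => by
    simp only [TensorProduct.map_tmul, ContinuousLinearMap.coe_coe,
      InnerProductSpace.rankOne_apply, TensorProduct.smul_tmul_smul, TensorProduct.inner_tmul]

theorem finrank_range_rankOne {x : E} {y : F} (hx : x ≠ 0) (hy : y ≠ 0) :
    Module.finrank 𝕜 (LinearMap.range (InnerProductSpace.rankOne 𝕜 x y).toLinearMap) = 1 :=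
  Module.rank_eq_one_iff_finrank_eq_one.1 (InnerProductSpace.rank_rankOne hx hy)

theorem exists_eq_rankOne_of_isSymmetricProjection {p : E →ₗ[𝕜] E}
    (hp : p.IsSymmetricProjection) (hrank : Module.finrank 𝕜 (LinearMap.range p) = 1) :
    ∃ x : E, ‖x‖ = 1 ∧ p = (InnerProductSpace.rankOne 𝕜 x x).toLinearMap := by
  have : FiniteDimensional 𝕜 (LinearMap.range p) :=
    Module.finite_of_finrank_pos (hrank ▸ one_pos)
  obtain ⟨_, hproj⟩ := LinearMap.isSymmetricProjection_iff_eq_coe_starProjection_range.1 hp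
  let basis := (stdOrthonormalBasis 𝕜 (LinearMap.range p)).reindex (finCongr hrank)
  refine ⟨basis 0, basis.norm_eq_one 0, hproj.trans ?_⟩
  rw [basis.starProjection_eq_sum_rankOne, Fin.sum_univ_one]

end RankOne

theorem exists_orthonormalBasis_coe_eq {𝕜 E ι : Type*} [RCLike 𝕜] [NormedAddCommGroup E]
    [InnerProductSpace 𝕜 E] [Fintype ι] [Nonempty ι] {v : ι → E} (hv : Orthonormal 𝕜 v)
    (hcard : Fintype.card ι = Module.finrank 𝕜 E) :
    ∃ basis : OrthonormalBasis ι 𝕜 E, ⇑basis = v := by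
  have hcoe := coe_basisOfOrthonormalOfCardEqFinrank hv hcard
  exact ⟨(basisOfOrthonormalOfCardEqFinrank hv hcard).toOrthonormalBasis (by rwa [hcoe]),
    (Module.Basis.coe_toOrthonormalBasis _ _).trans hcoe⟩

/-! ### The reference realization -/

/-- Half the angle on the Bloch circle of the eigenvector for the eigenvalue `a` of the observable
`cos φ Z + sin φ X`; this is the vector onto which `qubitProj φ a` projects. -/
noncomputable def qubitAngle (φ : ℝ) (a : ℤˣ) : ℝ := if a = 1 then φ / 2 else φ / 2 + Real.pi / 2

theorem qubitProj_eq_rankOne (φ : ℝ) (a : ℤˣ) :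
    qubitProj φ a = (InnerProductSpace.rankOne ℂ (qubitVec (qubitAngle φ a))
      (qubitVec (qubitAngle φ a))).toLinearMap := rfl

theorem cos_two_mul_qubitAngle (φ : ℝ) (a : ℤˣ) :
    Real.cos (2 * qubitAngle φ a) = ((a : ℤ) : ℝ) * Real.cos φ := by
  rcases Int.units_eq_one_or a with rfl | rfl <;>
    simp [qubitAngle, mul_add, mul_div_cancel₀, Real.cos_add_pi]

theorem sin_two_mul_qubitAngle (φ : ℝ) (a : ℤˣ) :
    Real.sin (2 * qubitAngle φ a) = ((a : ℤ) : ℝ) * Real.sin φ := by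
  rcases Int.units_eq_one_or a with rfl | rfl <;>
    simp [qubitAngle, mul_add, mul_div_cancel₀, Real.sin_add_pi]

theorem cos_two_mul_qubitAngle_sub (φ θ : ℝ) (a b : ℤˣ) :
    Real.cos (2 * (qubitAngle φ a - qubitAngle θ b)) =
      (((a * b : ℤˣ) : ℤ) : ℝ) * Real.cos (φ - θ) := by
  rw [mul_sub, Real.cos_sub, cos_two_mul_qubitAngle, cos_two_mul_qubitAngle,
    sin_two_mul_qubitAngle, sin_two_mul_qubitAngle, Real.cos_sub]
  push_cast
  ring

theorem inner_qubitVec (s t : ℝ) :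
    inner ℂ (qubitVec s) (qubitVec t) = (Real.cos (s - t) : ℂ) := by
  rw [Real.cos_sub]
  simp [qubitVec, PiLp.inner_apply, mul_comm, -Complex.ofReal_cos, -Complex.ofReal_sin]

theorem orthonormal_qubitVec_qubitAngle (φ : ℝ) :
    Orthonormal ℂ fun a => qubitVec (qubitAngle φ a) := by
  refine ⟨fun _ => norm_qubitVec _, fun a b hab => ?_⟩
  rcases Int.units_eq_one_or a with rfl | rfl <;> rcases Int.units_eq_one_or b with rfl | rfl <;>
    simp [inner_qubitVec, qubitAngle] at hab ⊢

theorem sum_qubitProj (φ : ℝ) : ∑ a, qubitProj φ a = LinearMap.id := by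
  obtain ⟨basis, hbasis⟩ := exists_orthonormalBasis_coe_eq (orthonormal_qubitVec_qubitAngle φ)
    (by simp [Fintype.card_units_int])
  have hsum := congrArg ContinuousLinearMap.toLinearMap basis.sum_rankOne_eq_id
  simpa [hbasis, qubitProj_eq_rankOne] using hsum

theorem inner_qubitVec_tmul_phiPlus (s t : ℝ) :
    inner ℂ (qubitVec s ⊗ₜ[ℂ] qubitVec t) phiPlus = ((Real.cos (s - t) / √2 : ℝ) : ℂ) := by
  rw [phiPlus, inner_smul_right (E := Qubit ⊗[ℂ] Qubit), inner_add_right (E := Qubit ⊗[ℂ] Qubit),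
    TensorProduct.inner_tmul, TensorProduct.inner_tmul, Real.cos_sub]
  simp [qubitVec, EuclideanSpace.inner_single_right, -Complex.ofReal_cos, -Complex.ofReal_sin]
  ring

theorem inner_phiPlus_map_qubitProj_phiPlus (φ θ : ℝ) (a b : ℤˣ) :
    inner ℂ phiPlus (TensorProduct.map (qubitProj φ a) (qubitProj θ b) phiPlus) =
      (((1 + (((a * b : ℤˣ) : ℤ) : ℝ) * Real.cos (φ - θ)) / 4 : ℝ) : ℂ) := by
  rw [qubitProj_eq_rankOne, qubitProj_eq_rankOne, tensorProduct_map_rankOne,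
    ContinuousLinearMap.coe_coe, InnerProductSpace.inner_right_rankOne_apply,
    ← inner_conj_symm (E := Qubit ⊗[ℂ] Qubit), inner_qubitVec_tmul_phiPlus, Complex.conj_ofReal,
    ← Complex.ofReal_mul, ← cos_two_mul_qubitAngle_sub, Real.cos_two_mul, div_mul_div_comm,
    Real.mul_self_sqrt two_pos.le]
  congr 1
  ring

section ReferenceValue

variable (N : ℕ)

theorem chainedReference_isMeasurement : (chainedReference N).IsMeasurement :=
  ⟨fun _ => sum_qubitProj _, fun _ => sum_qubitProj _⟩

theorem chainedReference_isRankOne : (chainedReference N).IsRankOne := by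
  have hne : ∀ t, qubitVec t ≠ 0 := fun t =>
    norm_ne_zero_iff.1 ((norm_qubitVec t).trans_ne one_ne_zero)
  exact ⟨fun _ _ => finrank_range_rankOne (hne _) (hne _),
    fun _ _ => finrank_range_rankOne (hne _) (hne _)⟩

theorem chainedReference_prob (x y : Fin N) (a b : ℤˣ) :
    (chainedReference N).prob x y a b = (1 + (((a * b : ℤˣ) : ℤ) : ℝ) *
      Real.cos ((2 * (x : ℕ) - (2 * (y : ℕ) + 1)) * (Real.pi / (2 * N)))) / 4 := by
  rw [sub_mul]
  exact congrArg Complex.re (inner_phiPlus_map_qubitProj_phiPlus _ _ a b)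

theorem chainedReference_correlator (x y : Fin N) :
    (chainedReference N).correlator x y =
      Real.cos ((2 * (x : ℕ) - (2 * (y : ℕ) + 1)) * (Real.pi / (2 * N))) := by
  simp only [BellRealization.correlator, chainedReference_prob, sum_units_int, mul_one, mul_neg,
    neg_neg, Units.val_one, Units.val_neg, Int.cast_one, Int.cast_neg]
  ring

variable {N}

theorem chainSign_mul_correlator_chainedReference (e : Fin (2 * N)) :
    ((chainSign e : ℤ) : ℝ) * (chainedReference N).correlator (chainA e) (chainB e) =
      Real.cos (Real.pi / (2 * N)) := by
  have he := e.isLt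
  have hN : (N : ℝ) ≠ 0 := Nat.cast_ne_zero.2 (by omega)
  rw [chainedReference_correlator]
  simp only [chainSign, chainA, chainB]
  split_ifs with hlast
  · have hangle : (2 * ((0 : ℕ) : ℝ) - (2 * ((N - 1 : ℕ) : ℝ) + 1)) * (Real.pi / (2 * N)) =
        Real.pi / (2 * N) - Real.pi := by
      rw [Nat.cast_pred (by omega)]
      field_simp
      push_cast
      ring
    rw [hlast, Nat.mul_div_cancel_left _ two_pos, Nat.mod_self, show (e : ℕ) / 2 = N - 1 by omega,
      hangle, Real.cos_sub_pi]
    simp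
  · rw [Nat.mod_eq_of_lt (by omega), Units.val_one, Int.cast_one, one_mul]
    rcases Nat.even_or_odd' (e : ℕ) with ⟨k, hk | hk⟩
    · rw [show ((e : ℕ) + 1) / 2 = k by omega, show (e : ℕ) / 2 = k by omega, sub_add_cancel_left,
        neg_one_mul, Real.cos_neg]
    · rw [show ((e : ℕ) + 1) / 2 = k + 1 by omega, show (e : ℕ) / 2 = k by omega]
      push_cast
      congr 1
      ring

theorem chainedBell_chainedReference :
    chainedBell (chainedReference N) = 2 * N * Real.cos (Real.pi / (2 * N)) := by
  simp [chainedBell, chainSign_mul_correlator_chainedReference]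

theorem thetaObjective_chainedReference :
    thetaObjective (chainedGram (chainedReference N)) = N * (1 + Real.cos (Real.pi / (2 * N))) := by
  rw [(chainedReference_isMeasurement N).thetaObjective_eq, chainedBell_chainedReference]
  ring

end ReferenceValue

/-! ### Phases of local vectors -/

section LocalVectors

variable {HA HB : Type*} [NormedAddCommGroup HA] [InnerProductSpace ℂ HA]
  [NormedAddCommGroup HB] [InnerProductSpace ℂ HB]

theorem inner_smul_tmul_smul_tmul (s s' : ℂ) (a a' : HA) (b b' : HB) :
    inner ℂ (s • a ⊗ₜ[ℂ] b) (s' • a' ⊗ₜ[ℂ] b') =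
      starRingEnd ℂ s * s' * inner ℂ a a' * inner ℂ b b' := by
  rw [inner_smul_left (E := HA ⊗[ℂ] HB), inner_smul_right (E := HA ⊗[ℂ] HB),
    TensorProduct.inner_tmul]
  ring

/-- Contraction of the left factor of a tensor product with a fixed vector. -/
noncomputable def innerContractLeft (a : HA) : HA ⊗[ℂ] HB →ₗ[ℂ] HB :=
  (TensorProduct.lid ℂ HB).toLinearMap ∘ₗ (innerₛₗ ℂ a).rTensor HB

/-- Contraction of the right factor of a tensor product with a fixed vector. -/
noncomputable def innerContractRight (b : HB) : HA ⊗[ℂ] HB →ₗ[ℂ] HA :=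
  (TensorProduct.rid ℂ HA).toLinearMap ∘ₗ (innerₛₗ ℂ b).lTensor HA

theorem innerContractLeft_tmul (a a' : HA) (b : HB) :
    innerContractLeft a (a' ⊗ₜ[ℂ] b) = (inner ℂ a a' : ℂ) • b := by
  simp [innerContractLeft]

theorem innerContractRight_tmul (b b' : HB) (a : HA) :
    innerContractRight b (a ⊗ₜ[ℂ] b') = (inner ℂ b b' : ℂ) • a := by
  simp [innerContractRight]

theorem exists_left_eq_smul_of_tmul_eq_smul_tmul {a a' : HA} {b b' : HB} {κ : ℂ} (hb : ‖b‖ = 1)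
    (h : a ⊗ₜ[ℂ] b = κ • a' ⊗ₜ[ℂ] b') : ∃ μ : ℂ, a = μ • a' := by
  have hcontract := congrArg (innerContractRight b) h
  rw [map_smul, innerContractRight_tmul, innerContractRight_tmul,
    inner_self_eq_one_of_norm_eq_one hb, one_smul, smul_smul] at hcontract
  exact ⟨_, hcontract⟩

theorem exists_right_eq_smul_of_tmul_eq_smul_tmul {a a' : HA} {b b' : HB} {κ : ℂ} (ha : ‖a‖ = 1)
    (h : a ⊗ₜ[ℂ] b = κ • a' ⊗ₜ[ℂ] b') : ∃ μ : ℂ, b = μ • b' := by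
  have hcontract := congrArg (innerContractLeft a) h
  rw [map_smul, innerContractLeft_tmul, innerContractLeft_tmul,
    inner_self_eq_one_of_norm_eq_one ha, one_smul, smul_smul] at hcontract
  exact ⟨_, hcontract⟩

end LocalVectors

theorem orthonormal_smul_of_norm_eq_one {𝕜 E ι : Type*} [RCLike 𝕜] [NormedAddCommGroup E]
    [InnerProductSpace 𝕜 E] {x : ι → E} (hx : Orthonormal 𝕜 x) {φ : ι → 𝕜}
    (hφ : ∀ i, ‖φ i‖ = 1) : Orthonormal 𝕜 fun i => φ i • x i :=
  ⟨fun i => by rw [norm_smul, hφ, hx.1, one_mul], fun i j hij => by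
    simp only [inner_smul_left, inner_smul_right, hx.2 hij, mul_zero]⟩

theorem conj_mul_self_of_norm_eq_one {𝕜 : Type*} [RCLike 𝕜] {z : 𝕜} (hz : ‖z‖ = 1) :
    starRingEnd 𝕜 z * z = 1 := by
  rw [RCLike.conj_mul, hz, RCLike.ofReal_one, one_pow]

theorem orthonormal_units_int_iff {𝕜 E : Type*} [RCLike 𝕜] [NormedAddCommGroup E]
    [InnerProductSpace 𝕜 E] {x : ℤˣ → E} :
    Orthonormal 𝕜 x ↔ (∀ b, ‖x b‖ = 1) ∧ ∀ b, inner 𝕜 (x b) (x (-b)) = 0 := by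
  refine and_congr_right fun _ => ⟨fun h b => h (units_ne_neg_self b), fun h b b' hb => ?_⟩
  rw [← neg_eq_iff_eq_neg.2 (Int.units_ne_iff_eq_neg.1 hb)]
  exact h b

theorem exists_linearIsometry_of_orthonormal {𝕜 E E' ι : Type*} [RCLike 𝕜]
    [NormedAddCommGroup E] [InnerProductSpace 𝕜 E] [NormedAddCommGroup E'] [InnerProductSpace 𝕜 E']
    [Fintype ι] [Nonempty ι] {x : ι → E} {x' : ι → E'} (hx : Orthonormal 𝕜 x)
    (hcard : Fintype.card ι = Module.finrank 𝕜 E) (hx' : Orthonormal 𝕜 x') :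
    ∃ V : E →ₗᵢ[𝕜] E', ∀ i, V (x i) = x' i := by
  obtain ⟨basis, rfl⟩ := exists_orthonormalBasis_coe_eq hx hcard
  have hconstr : ∀ i, basis.toBasis.constr 𝕜 x' (basis i) = x' i := fun i => by
    rw [← basis.coe_toBasis, Module.Basis.constr_basis]
  exact ⟨(basis.toBasis.constr 𝕜 x').isometryOfOrthonormal (v := basis.toBasis)
    (by rwa [basis.coe_toBasis]) (by convert hx' using 1; ext i; simp [hconstr]), hconstr⟩

theorem rankOne_comp_of_map_eq_smul {𝕜 E E' : Type*} [RCLike 𝕜] [NormedAddCommGroup E]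
    [InnerProductSpace 𝕜 E] [NormedAddCommGroup E'] [InnerProductSpace 𝕜 E'] (V : E →ₗᵢ[𝕜] E')
    {x : E} {x' : E'} {κ : 𝕜} (hx : ‖x‖ = 1) (hx' : ‖x'‖ = 1) (h : V x = κ • x') :
    (InnerProductSpace.rankOne 𝕜 x' x').toLinearMap ∘ₗ V.toLinearMap =
      V.toLinearMap ∘ₗ (InnerProductSpace.rankOne 𝕜 x x).toLinearMap := by
  have hκ : ‖κ‖ = 1 := by simpa [norm_smul, hx, hx'] using (congrArg norm h).symm
  have hx'_eq : x' = starRingEnd 𝕜 κ • V x := by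
    rw [h, smul_smul, conj_mul_self_of_norm_eq_one hκ, one_smul]
  ext u
  simp only [LinearMap.comp_apply, ContinuousLinearMap.coe_coe, LinearIsometry.coe_toLinearMap,
    InnerProductSpace.rankOne_apply, map_smul]
  rw [hx'_eq, inner_smul_left, V.inner_map_map, smul_smul, mul_right_comm,
    RingHomCompTriple.comp_apply, RingHom.id_apply, mul_comm κ,
    conj_mul_self_of_norm_eq_one hκ, one_mul]

theorem eq_inner_smul_add_inner_smul {𝕜 E : Type*} [RCLike 𝕜] [NormedAddCommGroup E]
    [InnerProductSpace 𝕜 E] {x : ℤˣ → E} (hx : Orthonormal 𝕜 x) {y : E}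
    (hy : y ∈ Submodule.span 𝕜 (Set.range x)) (b : ℤˣ) :
    y = inner 𝕜 (x b) y • x b + inner 𝕜 (x (-b)) y • x (-b) := by
  obtain ⟨g, rfl⟩ := (Submodule.mem_span_range_iff_exists_fun 𝕜).1 hy
  rw [hx.inner_right_fintype, hx.inner_right_fintype, sum_units_int]
  rcases Int.units_eq_one_or b with rfl | rfl
  · rfl
  · rw [neg_neg, add_comm]

section PhasesOfRotation

variable {H : Type*} [NormedAddCommGroup H] [InnerProductSpace ℂ H] {x y : ℤˣ → H} {θ : ℝ}

theorem exists_eq_cos_smul_add_smul (hx : Orthonormal ℂ x) (hy : Orthonormal ℂ y)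
    (hspan : ∀ b, y b ∈ Submodule.span ℂ (Set.range x)) (hcos : Real.cos θ ≠ 0)
    (hsin : 0 ≤ Real.sin θ) (hxy : ∀ b, inner ℂ (x b) (y b) = (Real.cos θ : ℂ)) :
    ∃ d : ℂ, ‖d‖ = Real.sin θ ∧ y 1 = (Real.cos θ : ℂ) • x 1 + d • x (-1) ∧
      y (-1) = (Real.cos θ : ℂ) • x (-1) - starRingEnd ℂ d • x 1 := by
  have hpos := eq_inner_smul_add_inner_smul hx (hspan 1) 1
  have hneg := eq_inner_smul_add_inner_smul hx (hspan (-1)) (-1)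
  rw [hxy] at hpos hneg
  rw [neg_neg] at hneg
  set d : ℂ := inner ℂ (x (-1)) (y 1)
  have hx_orth : inner ℂ (x 1) (x (-1)) = 0 := (orthonormal_units_int_iff.1 hx).2 1
  have hx_orth' : inner ℂ (x (-1)) (x 1) = 0 := inner_eq_zero_symm.1 hx_orth
  have hx_self : ∀ b, inner ℂ (x b) (x b) = 1 := fun b =>
    inner_self_eq_one_of_norm_eq_one (hx.1 b)
  have hd_norm : ‖d‖ = Real.sin θ := by
    have hself := inner_self_eq_one_of_norm_eq_one (𝕜 := ℂ) (hy.1 1)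
    simp only [hpos, inner_add_left, inner_add_right, inner_smul_left, inner_smul_right, hx_self,
      hx_orth, hx_orth', Complex.conj_ofReal, mul_zero, mul_one, add_zero, zero_add] at hself
    rw [mul_comm d, Complex.conj_mul'] at hself
    have hpythagoras : Real.cos θ * Real.cos θ + ‖d‖ ^ 2 = 1 := by exact_mod_cast hself
    refine (sq_eq_sq₀ (norm_nonneg _) hsin).1 ?_
    linear_combination hpythagoras - Real.sin_sq_add_cos_sq θ
  have hd_conj : inner ℂ (x 1) (y (-1)) = -starRingEnd ℂ d := by
    have horth := (orthonormal_units_int_iff.1 hy).2 1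
    rw [hpos, hneg] at horth
    simp only [inner_add_left, inner_add_right, inner_smul_left, inner_smul_right, hx_self,
      hx_orth, hx_orth', Complex.conj_ofReal] at horth
    exact mul_left_cancel₀ (Complex.ofReal_ne_zero.2 hcos) (by linear_combination horth)
  exact ⟨d, hd_norm, hpos, by rw [sub_eq_add_neg, ← neg_smul, ← hd_conj]; exact hneg⟩

theorem exists_phases_smul_eq_rotation (hx : Orthonormal ℂ x) (hy : Orthonormal ℂ y)
    (hspan : ∀ b, y b ∈ Submodule.span ℂ (Set.range x)) (hcos : Real.cos θ ≠ 0)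
    (hsin : 0 < Real.sin θ) (hxy : ∀ b, inner ℂ (x b) (y b) = (Real.cos θ : ℂ)) :
    ∃ φ : ℤˣ → ℂ, (∀ b, ‖φ b‖ = 1) ∧ ∀ b, φ b • y b =
      (Real.cos θ : ℂ) • φ b • x b + ((b : ℤ) * Real.sin θ : ℂ) • φ (-b) • x (-b) := by
  have hsin0 : (Real.sin θ : ℂ) ≠ 0 := Complex.ofReal_ne_zero.2 hsin.ne'
  obtain ⟨d, hd, hpos, hneg⟩ := exists_eq_cos_smul_add_smul hx hy hspan hcos hsin.le hxy
  obtain ⟨μ, rfl⟩ : ∃ μ : ℂ, d = Real.sin θ * μ := ⟨_, (mul_div_cancel₀ d hsin0).symm⟩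
  have hμ : ‖μ‖ = 1 := by
    rw [norm_mul, Complex.norm_real, Real.norm_of_nonneg hsin.le] at hd
    exact (mul_eq_left₀ hsin.ne').1 hd
  refine ⟨fun b => if b = 1 then 1 else μ, fun b => ?_, fun b => ?_⟩
  · beta_reduce
    split_ifs
    exacts [norm_one, hμ]
  · rcases Int.units_eq_one_or b with rfl | rfl
    · simp [hpos, smul_smul]
    · have hconj := conj_mul_self_of_norm_eq_one hμ
      simp only [hneg, map_mul, Complex.conj_ofReal, neg_neg, Units.val_neg, Units.val_one,
        Int.cast_neg, Int.cast_one, if_true, if_neg (by decide : (-1 : ℤˣ) ≠ 1)]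
      linear_combination (norm := module) hconj • (-(Real.sin θ : ℂ) • x 1)

end PhasesOfRotation

/-! ### Extremal ladder families of product vectors -/

namespace IsLadderFamily.IsExtremal

variable {H H' : Type*} [NormedAddCommGroup H] [InnerProductSpace ℂ H] [NormedAddCommGroup H']
  [InnerProductSpace ℂ H'] {n : ℕ} {f : H} {v : ℕ → ℤˣ → H} {f' : H'} {v' : ℕ → ℤˣ → H'}

theorem inner_succ_eq (h : IsExtremal n f v) (hn : 3 ≤ n) (e : ℕ) (b : ℤˣ) :
    inner ℂ (v e b) (v (e + 1) b) =
      ((√(1 + Real.cos (Real.pi / n)) / 2 : ℝ) : ℂ) ^ 2 * Real.cos (Real.pi / n) := by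
  have hsqrt := Real.sq_sqrt (one_add_cos_pi_div_pos (n := n) (by omega)).le
  rw [h.inner_add hn, Int.units_mul_self, ← Complex.ofReal_pow, ← Complex.ofReal_mul, div_pow,
    hsqrt, Nat.cast_one, one_mul, pow_one, Units.val_one, Int.cast_one]
  congr 1
  ring

theorem inner_add_two_neg_ne_zero (h : IsExtremal n f v) (hn : 3 ≤ n) (e : ℕ) (b : ℤˣ) :
    inner ℂ (v e b) (v (e + 2) (-b)) ≠ 0 := by
  have hpos := one_add_cos_pi_div_pos (n := n) (by omega)
  have hsq := cos_pi_div_sq_lt_one (n := n) (by omega)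
  rw [h.inner_add hn, mul_neg, Int.units_mul_self, Complex.ofReal_ne_zero, Nat.cast_ofNat,
    Real.cos_two_mul]
  refine mul_ne_zero (by positivity) fun hzero => ?_
  push_cast at hzero
  linarith

theorem ne_zero (h : IsExtremal n f v) (hn : 3 ≤ n) (e : ℕ) (b : ℤˣ) : v e b ≠ 0 := by
  have hpos := one_add_cos_pi_div_pos (n := n) (by omega)
  rw [← norm_ne_zero_iff, h.norm_eq hn]
  positivity

theorem map_eq_of_map_one_of_map_two (h : IsExtremal n f v) (h' : IsExtremal n f' v') (hn : 2 ≤ n)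
    (T : H →ₗ[ℂ] H') (hone : ∀ b, T (v 1 b) = v' 1 b) (htwo : ∀ b, T (v 2 b) = v' 2 b) :
    T f = f' ∧ ∀ e b, T (v e b) = v' e b := by
  have hn0 : n ≠ 0 := by omega
  have hsucc : ∀ e b, T (v (e + 1) b) = v' (e + 1) b := fun e => by
    induction e using Nat.twoStepInduction with
    | zero => exact hone
    | one => exact htwo
    | more e ih ih' =>
      intro b
      rw [h.add_two hn0 (e + 1), h'.add_two hn0 (e + 1), map_add, map_smul, map_sub, ih, ih', ih']
  have hbase : (1 + Real.cos (Real.pi / n) : ℂ) ≠ 0 := by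
    exact_mod_cast (one_add_cos_pi_div_pos hn).ne'
  refine ⟨smul_right_injective _ hbase ?_, fun e b => ?_⟩
  · have hsum := h.sum_succ hn0 1
    have hsum' := h'.sum_succ hn0 1
    rw [eq_sub_iff_add_eq] at hsum hsum'
    simp only [← map_smul, ← hsum, ← hsum', ladderSum, map_add, hone, htwo]
  · obtain ⟨k, hk⟩ : ∃ k, e + n = k + 1 := ⟨e + n - 1, by omega⟩
    rw [← neg_neg b, ← h.shift, ← h'.shift, hk, hsucc]

end IsLadderFamily.IsExtremal

/-- An extremal ladder family that consists of multiples of product vectors, in which consecutive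
rungs alternately share the second factors `B k` and the first factors `A (k + 1)`. -/
structure IsProductExtremal {HA HB : Type*} [NormedAddCommGroup HA] [InnerProductSpace ℂ HA]
    [NormedAddCommGroup HB] [InnerProductSpace ℂ HB] (n : ℕ) (f : HA ⊗[ℂ] HB)
    (v : ℕ → ℤˣ → HA ⊗[ℂ] HB) (A : ℕ → ℤˣ → HA) (B : ℕ → ℤˣ → HB) : Prop where
  isExtremal : IsLadderFamily.IsExtremal n f v
  norm_left : ∀ k b, ‖A k b‖ = 1
  norm_right : ∀ k b, ‖B k b‖ = 1
  exists_even : ∀ k b, ∃ s : ℂ, v (2 * k) b = s • A k b ⊗ₜ[ℂ] B k b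
  exists_odd : ∀ k b, ∃ s : ℂ, v (2 * k + 1) b = s • A (k + 1) b ⊗ₜ[ℂ] B k b

namespace IsProductExtremal

variable {HA HB : Type*} [NormedAddCommGroup HA] [InnerProductSpace ℂ HA]
  [NormedAddCommGroup HB] [InnerProductSpace ℂ HB] {n : ℕ} {f : HA ⊗[ℂ] HB}
  {v : ℕ → ℤˣ → HA ⊗[ℂ] HB} {A : ℕ → ℤˣ → HA} {B : ℕ → ℤˣ → HB}

theorem orthonormal_right (h : IsProductExtremal n f v A B) (hn : 3 ≤ n) (k : ℕ) :
    Orthonormal ℂ (B k) := by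
  refine orthonormal_units_int_iff.2 ⟨h.norm_right k, fun b => ?_⟩
  obtain ⟨s, hs⟩ := h.exists_even k b
  obtain ⟨s', hs'⟩ := h.exists_odd k (-b)
  obtain ⟨s'', hs''⟩ := h.exists_even (k + 1) (-b)
  have hlink := h.isExtremal.link (2 * k) b
  have hne := h.isExtremal.inner_add_two_neg_ne_zero hn (2 * k) b
  have hne' := h.isExtremal.ne_zero hn (2 * k + 1) (-b)
  rw [hs, hs', inner_smul_tmul_smul_tmul] at hlink
  rw [hs, ← mul_add_one 2 k, hs'', inner_smul_tmul_smul_tmul] at hne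
  rw [hs', smul_ne_zero_iff] at hne'
  simp only [ne_eq, mul_eq_zero, not_or] at hlink hne
  tauto

theorem orthonormal_left (h : IsProductExtremal n f v A B) (hn : 3 ≤ n) (k : ℕ) :
    Orthonormal ℂ (A (k + 1)) := by
  refine orthonormal_units_int_iff.2 ⟨h.norm_left (k + 1), fun b => ?_⟩
  obtain ⟨s, hs⟩ := h.exists_odd k b
  obtain ⟨s', hs'⟩ := h.exists_even (k + 1) (-b)
  obtain ⟨s'', hs''⟩ := h.exists_odd (k + 1) (-b)
  have hlink := h.isExtremal.link (2 * k + 1) b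
  have hne := h.isExtremal.inner_add_two_neg_ne_zero hn (2 * k + 1) b
  have hne' := h.isExtremal.ne_zero hn (2 * k + 2) (-b)
  rw [add_assoc, one_add_one_eq_two, ← mul_add_one 2 k, hs, hs', inner_smul_tmul_smul_tmul] at hlink
  rw [hs, add_right_comm, ← mul_add_one 2 k, hs'', inner_smul_tmul_smul_tmul] at hne
  rw [← mul_add_one 2 k, hs', smul_ne_zero_iff] at hne'
  simp only [ne_eq, mul_eq_zero, not_or] at hlink hne
  tauto

theorem right_mem_span (h : IsProductExtremal n f v A B) (hn : 3 ≤ n) (b : ℤˣ) :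
    B 1 b ∈ Submodule.span ℂ (Set.range (B 0)) := by
  choose s hs using h.exists_odd 0
  choose s' hs' using h.exists_odd 1
  have hs'_ne : s' b ≠ 0 := (smul_ne_zero_iff.1 (hs' b ▸ h.isExtremal.ne_zero hn 3 b)).1
  have hsum : v 3 b + v 3 (-b) = v 1 1 + v 1 (-1) := by
    rw [← ladderSum, ← h.isExtremal.sum_add_two (by omega), ladderSum]
    rcases Int.units_eq_one_or b with rfl | rfl
    exacts [rfl, add_comm _ _]
  have hcontract := congrArg (innerContractLeft (A 2 b)) hsum
  rw [hs' b, hs' (-b), hs 1, hs (-1)] at hcontract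
  simp only [map_add, map_smul, innerContractLeft_tmul, Nat.reduceAdd,
    inner_self_eq_one_of_norm_eq_one (h.norm_left 2 b), one_smul,
    (orthonormal_units_int_iff.1 (h.orthonormal_left hn 1)).2 b, zero_smul, smul_zero,
    add_zero] at hcontract
  rw [← Submodule.smul_mem_iff _ hs'_ne, hcontract]
  have hmem : ∀ b, B 0 b ∈ Submodule.span ℂ (Set.range (B 0)) := fun b =>
    Submodule.subset_span (Set.mem_range_self b)
  exact add_mem (Submodule.smul_mem _ _ (Submodule.smul_mem _ _ (hmem _)))
    (Submodule.smul_mem _ _ (Submodule.smul_mem _ _ (hmem _)))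

theorem exists_eq_norm_smul_tmul (h : IsProductExtremal n f v A B) (hn : 3 ≤ n) :
    ∃ (a : ℤˣ → HA) (x y : ℤˣ → HB), Orthonormal ℂ a ∧ Orthonormal ℂ x ∧ Orthonormal ℂ y ∧
      (∀ b, y b ∈ Submodule.span ℂ (Set.range x)) ∧
      (∀ b, v 1 b = ((√(1 + Real.cos (Real.pi / n)) / 2 : ℝ) : ℂ) • a b ⊗ₜ[ℂ] x b) ∧
      ∀ b, v 2 b = ((√(1 + Real.cos (Real.pi / n)) / 2 : ℝ) : ℂ) • a b ⊗ₜ[ℂ] y b := by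
  set r := √(1 + Real.cos (Real.pi / n)) / 2
  have hr : 0 < r := div_pos (Real.sqrt_pos.2 (one_add_cos_pi_div_pos (by omega))) two_pos
  have hr0 : (r : ℂ) ≠ 0 := Complex.ofReal_ne_zero.2 hr.ne'
  choose s hs using h.exists_odd 0
  choose t ht using h.exists_even 1
  have hs_norm : ∀ b, ‖s b‖ = r := fun b => by
    simpa [hs, norm_smul, h.norm_left, h.norm_right] using h.isExtremal.norm_eq hn 1 b
  have ht_norm : ∀ b, ‖t b‖ = r := fun b => by
    simpa [ht, norm_smul, h.norm_left, h.norm_right] using h.isExtremal.norm_eq hn 2 b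
  have hs0 : ∀ b, s b ≠ 0 := fun b => norm_ne_zero_iff.1 (hs_norm b ▸ hr.ne')
  refine ⟨fun b => (s b / r) • A 1 b, B 0, fun b => (t b / s b) • B 1 b,
    orthonormal_smul_of_norm_eq_one (h.orthonormal_left hn 0) fun b => ?_, h.orthonormal_right hn 0,
    orthonormal_smul_of_norm_eq_one (h.orthonormal_right hn 1) fun b => ?_,
    fun b => Submodule.smul_mem _ _ (h.right_mem_span hn b), fun b => ?_, fun b => ?_⟩
  · rw [norm_div, hs_norm, Complex.norm_real, Real.norm_of_nonneg hr.le, div_self hr.ne']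
  · rw [norm_div, hs_norm, ht_norm, div_self hr.ne']
  · rw [← TensorProduct.smul_tmul', smul_smul, mul_div_cancel₀ _ hr0]
    exact hs b
  · rw [← TensorProduct.smul_tmul', TensorProduct.tmul_smul, smul_smul, smul_smul,
      mul_div_cancel₀ _ hr0, mul_div_cancel₀ _ (hs0 b)]
    exact ht b

theorem exists_eq_norm_smul_tmul_rotation (h : IsProductExtremal n f v A B) (hn : 3 ≤ n) :
    ∃ (a : ℤˣ → HA) (x : ℤˣ → HB), Orthonormal ℂ a ∧ Orthonormal ℂ x ∧
      (∀ b, v 1 b = ((√(1 + Real.cos (Real.pi / n)) / 2 : ℝ) : ℂ) • a b ⊗ₜ[ℂ] x b) ∧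
      ∀ b, v 2 b = ((√(1 + Real.cos (Real.pi / n)) / 2 : ℝ) : ℂ) • a b ⊗ₜ[ℂ]
        ((Real.cos (Real.pi / n) : ℂ) • x b +
          ((b : ℤ) * Real.sin (Real.pi / n) : ℂ) • x (-b)) := by
  obtain ⟨a, x, y, ha, hx, hy, hspan, hone, htwo⟩ := h.exists_eq_norm_smul_tmul hn
  set r := √(1 + Real.cos (Real.pi / n)) / 2
  have hr : 0 < r := div_pos (Real.sqrt_pos.2 (one_add_cos_pi_div_pos (by omega))) two_pos
  have hxy : ∀ b, inner ℂ (x b) (y b) = (Real.cos (Real.pi / n) : ℂ) := fun b => by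
    have hinner := h.isExtremal.inner_succ_eq hn 1 b
    rw [hone, htwo, inner_smul_tmul_smul_tmul, Complex.conj_ofReal,
      inner_self_eq_one_of_norm_eq_one (ha.1 b), mul_one, ← sq] at hinner
    exact mul_left_cancel₀ (pow_ne_zero 2 (Complex.ofReal_ne_zero.2 hr.ne')) hinner
  obtain ⟨φ, hφ, hrotation⟩ := exists_phases_smul_eq_rotation hx hy hspan
    (cos_pi_div_pos hn).ne' (sin_pi_div_pos (by omega)) hxy
  have htransfer : ∀ b (z : HB), a b ⊗ₜ[ℂ] z = (starRingEnd ℂ (φ b) • a b) ⊗ₜ[ℂ] (φ b • z) :=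
    fun b z => by
      rw [TensorProduct.smul_tmul_smul, conj_mul_self_of_norm_eq_one (hφ b), one_smul]
  refine ⟨fun b => starRingEnd ℂ (φ b) • a b, fun b => φ b • x b,
    orthonormal_smul_of_norm_eq_one ha fun b => (RCLike.norm_conj _).trans (hφ b),
    orthonormal_smul_of_norm_eq_one hx hφ, fun b => ?_, fun b => ?_⟩
  · rw [hone, htransfer]
  · rw [htwo, htransfer, hrotation]

variable {HA' HB' : Type*} [NormedAddCommGroup HA'] [InnerProductSpace ℂ HA']
  [NormedAddCommGroup HB'] [InnerProductSpace ℂ HB'] {f' : HA' ⊗[ℂ] HB'}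
  {v' : ℕ → ℤˣ → HA' ⊗[ℂ] HB'} {A' : ℕ → ℤˣ → HA'} {B' : ℕ → ℤˣ → HB'}

theorem exists_linearIsometry_map_eq (h : IsProductExtremal n f v A B)
    (h' : IsProductExtremal n f' v' A' B') (hn : 3 ≤ n) (hHA : Module.finrank ℂ HA = 2)
    (hHB : Module.finrank ℂ HB = 2) :
    ∃ (VA : HA →ₗᵢ[ℂ] HA') (VB : HB →ₗᵢ[ℂ] HB'),
      TensorProduct.map VA.toLinearMap VB.toLinearMap f = f' ∧
      ∀ e b, TensorProduct.map VA.toLinearMap VB.toLinearMap (v e b) = v' e b := by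
  obtain ⟨a, x, ha, hx, hone, htwo⟩ := h.exists_eq_norm_smul_tmul_rotation hn
  obtain ⟨a', x', ha', hx', hone', htwo'⟩ := h'.exists_eq_norm_smul_tmul_rotation hn
  obtain ⟨VA, hVA⟩ := exists_linearIsometry_of_orthonormal ha
    (Fintype.card_units_int.trans hHA.symm) ha'
  obtain ⟨VB, hVB⟩ := exists_linearIsometry_of_orthonormal hx
    (Fintype.card_units_int.trans hHB.symm) hx'
  refine ⟨VA, VB, h.isExtremal.map_eq_of_map_one_of_map_two h'.isExtremal (by omega) _
    (fun b => ?_) fun b => ?_⟩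
  · simp only [hone, hone', map_smul, TensorProduct.map_tmul, LinearIsometry.coe_toLinearMap, hVA,
      hVB]
  · simp only [htwo, htwo', map_smul, map_add, TensorProduct.map_tmul,
      LinearIsometry.coe_toLinearMap, hVA, hVB]

theorem exists_map_eq_smul (h : IsProductExtremal n f v A B)
    (h' : IsProductExtremal n f' v' A' B') (hn : 3 ≤ n) {VA : HA →ₗᵢ[ℂ] HA'} {VB : HB →ₗᵢ[ℂ] HB'}
    (hmap : ∀ e b, TensorProduct.map VA.toLinearMap VB.toLinearMap (v e b) = v' e b)
    (k : ℕ) (b : ℤˣ) :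
    (∃ κ : ℂ, VA (A k b) = κ • A' k b) ∧ ∃ κ : ℂ, VB (B k b) = κ • B' k b := by
  obtain ⟨s, hs⟩ := h.exists_even k b
  obtain ⟨s', hs'⟩ := h'.exists_even k b
  have hs0 : s ≠ 0 := (smul_ne_zero_iff.1 (hs ▸ h.isExtremal.ne_zero hn (2 * k) b)).1
  have hprod : VA (A k b) ⊗ₜ[ℂ] VB (B k b) = (s⁻¹ * s') • A' k b ⊗ₜ[ℂ] B' k b := by
    rw [mul_smul, ← hs', ← hmap, hs, map_smul, inv_smul_smul₀ hs0]
    rfl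
  exact ⟨exists_left_eq_smul_of_tmul_eq_smul_tmul ((VB.norm_map _).trans (h.norm_right k b)) hprod,
    exists_right_eq_smul_of_tmul_eq_smul_tmul ((VA.norm_map _).trans (h.norm_left k b)) hprod⟩

end IsProductExtremal

/-! ### Self-testing -/

namespace BellRealization

variable {N : ℕ} [NeZero N] {HA HB : Type*} [NormedAddCommGroup HA] [InnerProductSpace ℂ HA]
  [NormedAddCommGroup HB] [InnerProductSpace ℂ HB]

theorem exists_isProductExtremal {S : BellRealization N HA HB} (hS : S.IsRankOne)
    (hext : IsLadderFamily.IsExtremal (2 * N) S.state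
      fun e b => chainedVec S (some (ladderEvent N e b))) :
    ∃ (A : ℕ → ℤˣ → HA) (B : ℕ → ℤˣ → HB),
      IsProductExtremal (2 * N) S.state (fun e b => chainedVec S (some (ladderEvent N e b))) A B ∧
      (∀ (x : Fin N) a, S.projA x a = (InnerProductSpace.rankOne ℂ (A x a) (A x a)).toLinearMap) ∧
      ∀ (y : Fin N) b, S.projB y b =
        (InnerProductSpace.rankOne ℂ (B y b) (B y b)).toLinearMap := by
  choose α hα hA using fun x a =>
    exists_eq_rankOne_of_isSymmetricProjection (S.projA_isProj x a) (hS.1 x a)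
  choose β hβ hB using fun y b =>
    exists_eq_rankOne_of_isSymmetricProjection (S.projB_isProj y b) (hS.2 y b)
  have hvec : ∀ e b, ∃ s : ℂ, chainedVec S (some (ladderEvent N e b)) =
      s • α (Fin.ofNat N ((e + 1) / 2)) ((-1) ^ ((e + 1) / 2 / N) * b) ⊗ₜ[ℂ]
        β (Fin.ofNat N (e / 2)) ((-1) ^ (e / 2 / N) * b) := fun e b => by
    rw [chainedVec, eventVec, chainA_ladderEvent, chainB_ladderEvent, snd_ladderEvent,
      outB_ladderEvent, hA, hB, tensorProduct_map_rankOne]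
    exact ⟨_, rfl⟩
  refine ⟨fun k b => α (Fin.ofNat N k) ((-1) ^ (k / N) * b),
    fun k b => β (Fin.ofNat N k) ((-1) ^ (k / N) * b),
    ⟨hext, fun _ _ => hα _ _, fun _ _ => hβ _ _, fun k b => ?_, fun k b => ?_⟩,
    fun x a => ?_, fun y b => ?_⟩
  · have hk := hvec (2 * k) b
    rwa [show (2 * k + 1) / 2 = k by omega, show 2 * k / 2 = k by omega] at hk
  · have hk := hvec (2 * k + 1) b
    rwa [show (2 * k + 1 + 1) / 2 = k + 1 by omega, show (2 * k + 1) / 2 = k by omega] at hk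
  · simp only [Fin.ofNat_val_eq_self, Nat.div_eq_of_lt x.isLt, pow_zero, one_mul, hA]
  · simp only [Fin.ofNat_val_eq_self, Nat.div_eq_of_lt y.isLt, pow_zero, one_mul, hB]

theorem exists_linearIsometry_map_eq {HA' HB' : Type*} [NormedAddCommGroup HA']
    [InnerProductSpace ℂ HA'] [NormedAddCommGroup HB'] [InnerProductSpace ℂ HB'] (hN : 2 ≤ N)
    {R : BellRealization N HA HB} {S : BellRealization N HA' HB'} (hR : R.IsRankOne)
    (hS : S.IsRankOne)
    (hRext : IsLadderFamily.IsExtremal (2 * N) R.state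
      fun e b => chainedVec R (some (ladderEvent N e b)))
    (hSext : IsLadderFamily.IsExtremal (2 * N) S.state
      fun e b => chainedVec S (some (ladderEvent N e b)))
    (hHA : Module.finrank ℂ HA = 2) (hHB : Module.finrank ℂ HB = 2) :
    ∃ (VA : HA →ₗᵢ[ℂ] HA') (VB : HB →ₗᵢ[ℂ] HB'),
      TensorProduct.map VA.toLinearMap VB.toLinearMap R.state = S.state ∧
      ∀ x y a b, TensorProduct.map VA.toLinearMap VB.toLinearMap (R.eventVec x y a b) =
        S.eventVec x y a b := by
  have hn : 3 ≤ 2 * N := by omega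
  obtain ⟨A, B, h, hRA, hRB⟩ := exists_isProductExtremal hR hRext
  obtain ⟨A', B', h', hSA, hSB⟩ := exists_isProductExtremal hS hSext
  obtain ⟨VA, VB, hstate, hmap⟩ := h.exists_linearIsometry_map_eq h' hn hHA hHB
  refine ⟨VA, VB, hstate, fun x y a b => ?_⟩
  obtain ⟨_, hκ⟩ := (h.exists_map_eq_smul h' hn hmap x a).1
  obtain ⟨_, hμ⟩ := (h.exists_map_eq_smul h' hn hmap y b).2
  rw [eventVec, eventVec, ← hstate, hRA, hRB, hSA, hSB, ← LinearMap.comp_apply,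
    ← LinearMap.comp_apply, ← TensorProduct.map_comp, ← TensorProduct.map_comp,
    rankOne_comp_of_map_eq_smul VA (h.norm_left _ _) (h'.norm_left _ _) hκ,
    rankOne_comp_of_map_eq_smul VB (h.norm_right _ _) (h'.norm_right _ _) hμ]

end BellRealization

theorem rank_le_card_of_sum_eq_id {K E ι : Type*} [Field K] [AddCommGroup E] [Module K E]
    [Fintype ι] {p : ι → E →ₗ[K] E} (hrank : ∀ i, Module.finrank K (LinearMap.range (p i)) = 1)
    (hsum : ∑ i, p i = LinearMap.id) : Module.rank K E ≤ Fintype.card ι := by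
  have hle := LinearMap.rank_finsetSum_le Finset.univ p
  rw [hsum, LinearMap.rank, LinearMap.range_id, rank_top] at hle
  simpa [LinearMap.rank, Module.rank_eq_one_iff_finrank_eq_one.2 (hrank _)] using hle

theorem finite_and_finrank_eq_of_sum_eq_id {K E F ι : Type*} [Field K] [AddCommGroup E]
    [Module K E] [AddCommGroup F] [Module K F] [Fintype ι] {p : ι → E →ₗ[K] E}
    (hrank : ∀ i, Module.finrank K (LinearMap.range (p i)) = 1)
    (hsum : ∑ i, p i = LinearMap.id) (hF : Module.finrank K F = Fintype.card ι) {V : F →ₗ[K] E}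
    (hV : Function.Injective V) :
    Module.Finite K E ∧ Module.finrank K F = Module.finrank K E := by
  have hle := rank_le_card_of_sum_eq_id hrank hsum
  have : Module.Finite K E :=
    Module.rank_lt_aleph0_iff.1 (hle.trans_lt Cardinal.natCast_lt_aleph0)
  exact ⟨this, (LinearMap.finrank_le_finrank_of_injective hV).antisymm
    ((Module.finrank_le_of_rank_le hle).trans_eq hF.symm)⟩

section ChainedReference

variable {N : ℕ} [NeZero N]

theorem isThetaOptimal_chainedReference :
    IsThetaOptimal (chainedExclusivityGraph N) (chainedGram (chainedReference N)) :=
  ⟨(chainedReference_isMeasurement N).thetaFeasible, fun _ hY =>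
    hY.thetaObjective_le.trans_eq thetaObjective_chainedReference.symm⟩

theorem IsThetaOptimal.thetaObjective_eq
    {X : Matrix (Option (ChainEvent N)) (Option (ChainEvent N)) ℂ}
    (h : IsThetaOptimal (chainedExclusivityGraph N) X) :
    thetaObjective X = N * (1 + Real.cos (Real.pi / (2 * N))) :=
  h.1.thetaObjective_le.antisymm <| thetaObjective_chainedReference.symm.trans_le <|
    h.2 _ (chainedReference_isMeasurement N).thetaFeasible

theorem exists_linearIsometry_of_thetaObjective_eq (hN : 2 ≤ N) {HA HB : Type*}
    [NormedAddCommGroup HA] [InnerProductSpace ℂ HA] [NormedAddCommGroup HB]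
    [InnerProductSpace ℂ HB] {S : BellRealization N HA HB} (hS : S.IsRankOne)
    (hfeasible : ThetaFeasible (chainedExclusivityGraph N) (chainedGram S))
    (hval : thetaObjective (chainedGram S) = N * (1 + Real.cos (Real.pi / (2 * N)))) :
    ∃ (VA : Qubit →ₗᵢ[ℂ] HA) (VB : Qubit →ₗᵢ[ℂ] HB),
      TensorProduct.map VA.toLinearMap VB.toLinearMap (chainedReference N).state = S.state ∧
      ∀ x y a b, TensorProduct.map VA.toLinearMap VB.toLinearMap
        ((chainedReference N).eventVec x y a b) = S.eventVec x y a b :=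
  BellRealization.exists_linearIsometry_map_eq hN (chainedReference_isRankOne N) hS
    ((chainedReference_isMeasurement N).isThetaFamily.isExtremal
      thetaObjective_chainedReference)
    ((thetaFeasible_transpose_gram_iff (w := chainedVec S).1 hfeasible).isExtremal hval)
    finrank_euclideanSpace_fin finrank_euclideanSpace_fin

end ChainedReference

theorem mainTheorem8 (N : ℕ) (hN : 2 ≤ N) :
    -- the standard realization consists of rank-one projective measurements and attains the value
    ((chainedReference N).IsMeasurement ∧ (chainedReference N).IsRankOne ∧
      chainedBell (chainedReference N) = 2 * N * Real.cos (Real.pi / (2 * N))) ∧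
    -- this value is the maximal quantum value
    (∀ (HA : Type u) (HB : Type v) [NormedAddCommGroup HA] [InnerProductSpace ℂ HA]
      [NormedAddCommGroup HB] [InnerProductSpace ℂ HB] (S : BellRealization N HA HB),
      S.IsMeasurement → chainedBell S ≤ 2 * N * Real.cos (Real.pi / (2 * N))) ∧
    -- self-testing from the maximal value, for rank-one projective measurements
    (∀ (HA : Type u) (HB : Type v) [NormedAddCommGroup HA] [InnerProductSpace ℂ HA]
      [NormedAddCommGroup HB] [InnerProductSpace ℂ HB] (S : BellRealization N HA HB),
      S.IsMeasurement → S.IsRankOne →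
      chainedBell S = 2 * N * Real.cos (Real.pi / (2 * N)) →
      ∃ (VA : Qubit ≃ₗᵢ[ℂ] HA) (VB : Qubit ≃ₗᵢ[ℂ] HB),
        TensorProduct.map (VA.toLinearEquiv : Qubit →ₗ[ℂ] HA) (VB.toLinearEquiv : Qubit →ₗ[ℂ] HB)
          (chainedReference N).state = S.state ∧
        ∀ (x y : Fin N) (a b : ℤˣ),
          TensorProduct.map (VA.toLinearEquiv : Qubit →ₗ[ℂ] HA) (VB.toLinearEquiv : Qubit →ₗ[ℂ] HB)
            ((chainedReference N).eventVec x y a b) = S.eventVec x y a b) ∧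
    -- the graph of exclusivity is the Moebius ladder, and the standard realization gives
    -- the unique maximizer of its theta program
    Nonempty (chainedExclusivityGraph N ≃g
      SimpleGraph.circulantGraph ({1, ((2 * N : ℕ) : ZMod (4 * N))} : Set (ZMod (4 * N)))) ∧
    (IsThetaOptimal (chainedExclusivityGraph N) (chainedGram (chainedReference N)) ∧
      thetaObjective (chainedGram (chainedReference N)) =
        N * (1 + Real.cos (Real.pi / (2 * N))) ∧
      ∀ X, IsThetaOptimal (chainedExclusivityGraph N) X →
        X = chainedGram (chainedReference N)) ∧
    -- self-testing for rank-one projections, not assumed complete, that realize the maximizer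
    (∀ (HA : Type u) (HB : Type v) [NormedAddCommGroup HA] [InnerProductSpace ℂ HA]
      [NormedAddCommGroup HB] [InnerProductSpace ℂ HB] (S : BellRealization N HA HB),
      S.IsRankOne → IsThetaOptimal (chainedExclusivityGraph N) (chainedGram S) →
      ∃ (VA : Qubit →ₗᵢ[ℂ] HA) (VB : Qubit →ₗᵢ[ℂ] HB),
        TensorProduct.map VA.toLinearMap VB.toLinearMap (chainedReference N).state = S.state ∧
        ∀ (x y : Fin N) (a b : ℤˣ),
          TensorProduct.map VA.toLinearMap VB.toLinearMap
            ((chainedReference N).eventVec x y a b) = S.eventVec x y a b) := by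
  have : NeZero N := ⟨by omega⟩
  refine ⟨⟨chainedReference_isMeasurement N, chainedReference_isRankOne N,
      chainedBell_chainedReference⟩, fun HA HB _ _ _ _ S hS => ?_,
    fun HA HB _ _ _ _ S hS hrank hval => ?_,
    nonempty_chainedExclusivityGraph_iso_circulantGraph hN,
    ⟨isThetaOptimal_chainedReference, thetaObjective_chainedReference, fun X hX =>
      hX.1.eq_of_thetaObjective_eq hN hX.thetaObjective_eq isThetaOptimal_chainedReference.1
        thetaObjective_chainedReference⟩,
    fun HA HB _ _ _ _ S hrank hoptimal =>
      exists_linearIsometry_of_thetaObjective_eq hN hrank hoptimal.1 hoptimal.thetaObjective_eq⟩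
  · have hle := hS.thetaFeasible.thetaObjective_le
    rw [hS.thetaObjective_eq] at hle
    linarith
  · obtain ⟨VA, VB, hstate, hevent⟩ := exists_linearIsometry_of_thetaObjective_eq hN hrank
      hS.thetaFeasible (by rw [hS.thetaObjective_eq, hval]; ring)
    have hcard : Module.finrank ℂ Qubit = Fintype.card ℤˣ :=
      finrank_euclideanSpace_fin.trans Fintype.card_units_int.symm
    obtain ⟨_, hHA⟩ :=
      finite_and_finrank_eq_of_sum_eq_id (hrank.1 0) (hS.1 0) hcard VA.injective
    obtain ⟨_, hHB⟩ :=
      finite_and_finrank_eq_of_sum_eq_id (hrank.2 0) (hS.2 0) hcard VB.injective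
    exact ⟨VA.toLinearIsometryEquiv hHA, VB.toLinearIsometryEquiv hHB, hstate, hevent⟩
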